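/- Let $p$ be a prime, let $K$ be a finite extension of $\mathbb{Q}_p$ with valuation ring $\mathcal{O}_K$ and residue field $\tilde K$, let $\bar K$ be an algebraic closure of $K$, and let $\Gamma_K = \mathrm{Gal}(\bar K/K)$. Let $f \in K(x)$ be a rational function of degree $d$ with $1 \le d < p$ which has good reduction, i.e. $f = P/Q$ with $P, Q \in \mathcal{O}_K[x]$ of degree at most $d$ whose reductions $\tilde P, \tilde Q \in \tilde K[x]$ are coprime and satisfy $\max(\deg \tilde P, \deg \tilde Q) = d$. Let $a \in \mathbb{P}^1(K)$. The preimage tree of $a$ has as its vertices of level $n \ge 0$ the points $x \in \mathbb{P}^1(\bar K)$ with $f^n(x) = a$, and an edge from each vertex $y$ of level $n+1$ to the vertex $f(y)$ of level $n$; the arboreal representation of $f$ with base point $a$ is the action of $\Gamma_K$ on this tree, viewed as a homomorphism from $\Gamma_K$ to the automorphism group of the tree. A branch over $a$ is a sequence $B = (\alpha_n)_{n \ge 0}$ in $\mathbb{P}^1(\bar K)$ with $\alpha_0 = a$ and $f(\alpha_{n+1}) = \alpha_n$ for all $n$; its branch representation is the homomorphism from $\Gamma_K$ to the automorphism group of the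 subtree formed by the Galois orbit of $B$ (whose vertices of level $n$ are the conjugates $\sigma(\alpha_n)$, $\sigma \in \Gamma_K$). Such a representation $\rho$ is unramified over a finite extension $L \subseteq \bar K$ of $K$ if the restriction of $\rho$ to $\Gamma_L = \mathrm{Gal}(\bar K/L)$ is trivial on the inertia subgroup of $\Gamma_L$, and it is infinitely ramified if there is no finite extension $L$ of $K$ over which it is unramified. If the arboreal representation of $f$ with base point $a$ is infinitely ramified, then there is a branch $B$ over $a$ whose branch representation is infinitely ramified. -/

import Mathlib

open Polynomial

namespace Arboreal

/-! ### `p`-adic fields, good reduction -/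

/-- An algebraic closure of an algebraic extension of `ℚ_p` is algebraic over `ℚ_p`. -/
instance isAlgebraic_algebraicClosure (p : ℕ) [Fact p.Prime] (K : Type*) [Field K]
    [Algebra ℚ_[p] K] [Algebra.IsAlgebraic ℚ_[p] K] :
    Algebra.IsAlgebraic ℚ_[p] (AlgebraicClosure K) :=
  Algebra.IsAlgebraic.trans ℚ_[p] K (AlgebraicClosure K)

/-- The valuation ring `𝓞_E = {x | |x| ≤ 1}` of an algebraic extension `E` of `ℚ_p`, where
`|·|` is the unique extension to `E` of the absolute value of `ℚ_p`. -/
noncomputable def integers (p : ℕ) [Fact p.Prime] (E : Type*) [Field E] [Algebra ℚ_[p] E]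
    [Algebra.IsAlgebraic ℚ_[p] E] : ValuationSubring E where
  carrier := {x | spectralNorm ℚ_[p] E x ≤ 1}
  mul_mem' {x y} hx hy := by
    have h := map_mul (spectralMulAlgNorm ℚ_[p] E) x y
    simp only [spectralMulAlgNorm_def] at h
    simp only [Set.mem_ofPred_eq] at hx hy ⊢
    rw [h]
    exact mul_le_one₀ hx (spectralNorm_nonneg _) hy
  one_mem' := (spectralNorm_one (K := ℚ_[p]) (L := E)).le
  add_mem' {x y} hx hy :=
    (isNonarchimedean_spectralNorm (K := ℚ_[p]) (L := E) x y).trans (max_le hx hy)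
  zero_mem' := by
    simp only [Set.mem_ofPred_eq, spectralNorm_zero]
    exact zero_le_one
  neg_mem' {x} hx := by
    simp only [Set.mem_ofPred_eq] at hx ⊢
    rwa [spectralNorm_neg (Algebra.IsAlgebraic.isAlgebraic x)]
  mem_or_inv_mem' x := by
    simp only [Set.mem_ofPred_eq]
    have h := map_inv₀ (spectralMulAlgNorm ℚ_[p] E) x
    simp only [spectralMulAlgNorm_def] at h
    rw [h]
    rcases le_total (spectralNorm ℚ_[p] E x) 1 with h1 | h1
    · exact Or.inl h1
    · exact Or.inr (inv_le_one_of_one_le₀ h1)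

/-- The degree of a rational function, as a self-map of the projective line. -/
noncomputable def ratDegree {K : Type*} [Field K] (f : RatFunc K) : ℕ :=
  max f.num.natDegree f.denom.natDegree

/-- Good reduction: `f = P / Q` with `P`, `Q` polynomials of degree at most `deg f` with
coefficients in the valuation ring, whose reductions are coprime and define a rational function
of the same degree `deg f` over the residue field. -/
def HasGoodReduction (p : ℕ) [Fact p.Prime] {K : Type*} [Field K] [Algebra ℚ_[p] K]
    [Algebra.IsAlgebraic ℚ_[p] K] (f : RatFunc K) : Prop :=
  ∃ P Q : (integers p K)[X],
    P.natDegree ≤ ratDegree f ∧ Q.natDegree ≤ ratDegree f ∧ Q ≠ 0 ∧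
    f = algebraMap K[X] (RatFunc K) (P.map (algebraMap (integers p K) K)) /
        algebraMap K[X] (RatFunc K) (Q.map (algebraMap (integers p K) K)) ∧
    IsCoprime (P.map (IsLocalRing.residue (integers p K)))
      (Q.map (IsLocalRing.residue (integers p K))) ∧
    max (P.map (IsLocalRing.residue (integers p K))).natDegree
      (Q.map (IsLocalRing.residue (integers p K))).natDegree = ratDegree f

/-! ### Rational maps on the projective line `ℙ¹(E) = E ∪ {∞}` -/

open Classical in
/-- The self-map of `ℙ¹(E) = E ∪ {∞}` defined by a rational function `f` over `K ⊆ E`. -/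
noncomputable def evalP1 {K E : Type*} [Field K] [Field E] [Algebra K E] (f : RatFunc K) :
    OnePoint E → OnePoint E
  | none =>
      if f.denom.natDegree < f.num.natDegree then OnePoint.infty
      else ((algebraMap K E (f.num.coeff f.denom.natDegree / f.denom.leadingCoeff) : E) :
        OnePoint E)
  | some x =>
      if aeval x f.denom = 0 then OnePoint.infty
      else ((aeval x f.num / aeval x f.denom : E) : OnePoint E)

/-- The map `ℙ¹(E) → ℙ¹(E)` defined by `f` over `K` commutes with `K`-automorphisms of `E`. -/
theorem evalP1_map {K E : Type*} [Field K] [Field E] [Algebra K E] (f : RatFunc K)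
    (σ : E ≃ₐ[K] E) (x : OnePoint E) :
    evalP1 f (x.map σ) = (evalP1 f x).map σ := by
  induction x using OnePoint.rec with
  | infty =>
    change evalP1 f none = (evalP1 f none).map σ
    simp only [evalP1]
    split_ifs
    · rfl
    · simp only [OnePoint.map_some, AlgEquiv.commutes]
  | coe x =>
    change evalP1 f (some (σ x)) = (evalP1 f (some x)).map σ
    have h : ∀ g : K[X], aeval (σ x) g = σ (aeval x g) := fun g =>
      aeval_algHom_apply (σ : E →ₐ[K] E) x g
    by_cases h0 : aeval x f.denom = 0
    · have h1 : aeval (σ x) f.denom = 0 := by rw [h, h0, map_zero]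
      simp only [evalP1, if_pos h0, if_pos h1, OnePoint.map_infty]
    · have h1 : aeval (σ x) f.denom ≠ 0 := by
        rw [h]
        exact (map_ne_zero_iff σ σ.injective).mpr h0
      simp only [evalP1, if_neg h0, if_neg h1, OnePoint.map_some, h, map_div₀]

/-! ### Trees of preimages, arboreal and branch representations -/

/-- A set `S` of pairs (level, point of `ℙ¹(E)`) is Galois stable. -/
def GaloisStable (K : Type*) {E : Type*} [Field K] [Field E] [Algebra K E]
    (S : Set (ℕ × OnePoint E)) : Prop :=
  ∀ σ : E ≃ₐ[K] E, ∀ v ∈ S, (v.1, v.2.map σ) ∈ S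

/-- The edges, directed towards the root, of the tree with set of vertices `S`: the vertex
`v = (n + 1, y)` is a child of `w = (n, x)` when `f y = x`. -/
def IsChild {K E : Type*} [Field K] [Field E] [Algebra K E] (f : RatFunc K)
    (S : Set (ℕ × OnePoint E)) (v w : S) : Prop :=
  v.1.1 = w.1.1 + 1 ∧ evalP1 f v.1.2 = w.1.2

/-- The automorphism group of the tree with set of vertices `S`. -/
abbrev TreeAut {K E : Type*} [Field K] [Field E] [Algebra K E] (f : RatFunc K)
    (S : Set (ℕ × OnePoint E)) : Type _ :=
  IsChild f S ≃r IsChild f S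

/-- The action of the Galois group on a Galois stable tree, as a homomorphism to the
automorphism group of the tree. -/
def treeRep {K E : Type*} [Field K] [Field E] [Algebra K E] (f : RatFunc K)
    (S : Set (ℕ × OnePoint E)) (hS : GaloisStable K S) :
    (E ≃ₐ[K] E) →* TreeAut f S where
  toFun σ :=
    { toFun := fun v => ⟨(v.1.1, v.1.2.map σ), hS σ v.1 v.2⟩
      invFun := fun v => ⟨(v.1.1, v.1.2.map σ.symm), hS σ.symm v.1 v.2⟩
      left_inv := fun ⟨⟨n, x⟩, hv⟩ => by
        induction x using OnePoint.rec <;> simp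
      right_inv := fun ⟨⟨n, x⟩, hv⟩ => by
        induction x using OnePoint.rec <;> simp
      map_rel_iff' := fun {v w} => by
        have hinj : Function.Injective (OnePoint.map σ : OnePoint E → OnePoint E) :=
          Option.map_injective σ.injective
        simp [IsChild, evalP1_map, hinj.eq_iff] }
  map_one' := by
    apply RelIso.ext
    rintro ⟨⟨n, x⟩, hv⟩
    apply Subtype.ext
    change (n, x.map (1 : E ≃ₐ[K] E)) = (n, x)
    induction x using OnePoint.rec <;> simp
  map_mul' σ τ := by
    apply RelIso.ext
    rintro ⟨⟨n, x⟩, hv⟩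
    apply Subtype.ext
    change (n, x.map (σ * τ)) = (n, (x.map τ).map σ)
    induction x using OnePoint.rec <;> simp

/-- The vertices of the full preimage tree of `a`: at level `n`, all `x ∈ ℙ¹(K̄)` with
`fⁿ(x) = a`. -/
def preimageTree {K : Type*} [Field K] (f : RatFunc K) (a : OnePoint K) :
    Set (ℕ × OnePoint (AlgebraicClosure K)) :=
  {v | (evalP1 f)^[v.1] v.2 = a.map (algebraMap K (AlgebraicClosure K))}

theorem preimageTree_stable {K : Type*} [Field K] (f : RatFunc K) (a : OnePoint K) :
    GaloisStable K (preimageTree f a) := by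
  rintro σ ⟨n, x⟩ hx
  simp only [preimageTree, Set.mem_ofPred_eq] at hx ⊢
  have h : Function.Commute (evalP1 f) (OnePoint.map σ) := fun y => evalP1_map f σ y
  rw [(h.iterate_left n).eq, hx]
  induction a using OnePoint.rec <;> simp

/-- The arboreal representation of `Γ_K` attached to `f` and the base point `a`. -/
noncomputable def arborealRep {K : Type*} [Field K] (f : RatFunc K) (a : OnePoint K) :
    (AlgebraicClosure K ≃ₐ[K] AlgebraicClosure K) →* TreeAut f (preimageTree f a) :=
  treeRep f (preimageTree f a) (preimageTree_stable f a)

/-- A branch for `f` over `K` with base point `a ∈ ℙ¹(K)`. -/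
structure Branch {K : Type*} [Field K] (f : RatFunc K) (a : OnePoint K) where
  /-- the `n`-th entry of the branch -/
  pt : ℕ → OnePoint (AlgebraicClosure K)
  pt_zero : pt 0 = a.map (algebraMap K (AlgebraicClosure K))
  evalP1_pt_succ : ∀ n, evalP1 f (pt (n + 1)) = pt n

/-- The vertices of the tree formed by the Galois orbit of a branch. -/
def Branch.tree {K : Type*} [Field K] {f : RatFunc K} {a : OnePoint K} (B : Branch f a) :
    Set (ℕ × OnePoint (AlgebraicClosure K)) :=
  {v | ∃ σ : AlgebraicClosure K ≃ₐ[K] AlgebraicClosure K, v.2 = (B.pt v.1).map σ}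

theorem Branch.tree_stable {K : Type*} [Field K] {f : RatFunc K} {a : OnePoint K}
    (B : Branch f a) : GaloisStable K B.tree := by
  rintro τ ⟨n, x⟩ ⟨σ, hσ⟩
  refine ⟨τ * σ, ?_⟩
  simp only at hσ ⊢
  rw [hσ]
  cases h : B.pt n using OnePoint.rec <;> simp

/-- The branch representation of `Γ_K` attached to a branch. -/
noncomputable def Branch.rep {K : Type*} [Field K] {f : RatFunc K} {a : OnePoint K}
    (B : Branch f a) :
    (AlgebraicClosure K ≃ₐ[K] AlgebraicClosure K) →* TreeAut f B.tree :=
  treeRep f B.tree B.tree_stable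

/-! ### Ramification -/

/-- A homomorphism from `Gal(E/F)` is unramified when it is trivial on the inertia subgroup,
i.e. factors through the unramified quotient. -/
def IsUnramified (p : ℕ) [Fact p.Prime] {F E : Type*} [Field F] [Field E] [Algebra F E]
    [Algebra ℚ_[p] E] [Algebra.IsAlgebraic ℚ_[p] E] {H : Type*} [Group H]
    (ρ : (E ≃ₐ[F] E) →* H) : Prop :=
  ((integers p E).inertiaSubgroup F).map
    ((integers p E).decompositionSubgroup F).subtype ≤ ρ.ker

/-- A homomorphism from `Γ_K` is infinitely ramified when there is no finite extension `L` of
`K` such that its restriction to `Γ_L` is unramified. -/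
def IsInfinitelyRamified (p : ℕ) [Fact p.Prime] {K : Type*} [Field K] [Algebra ℚ_[p] K]
    [Algebra.IsAlgebraic ℚ_[p] K] {H : Type*} [Group H]
    (ρ : (AlgebraicClosure K ≃ₐ[K] AlgebraicClosure K) →* H) : Prop :=
  ¬ ∃ L : IntermediateField K (AlgebraicClosure K), FiniteDimensional K L ∧
    IsUnramified p (F := L) (E := AlgebraicClosure K)
      (ρ.comp (AlgEquiv.restrictScalarsHom K :
        (AlgebraicClosure K ≃ₐ[L] AlgebraicClosure K) →*
          (AlgebraicClosure K ≃ₐ[K] AlgebraicClosure K)))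

end Arboreal

/-!
Write `v` for the absolute value of `K̄` and `ρ` for the chordal distance on `ℙ¹(K̄)`, so that the
residue discs are the classes of the relation `ρ(x, y) < 1`; the inertia group preserves every
residue disc. Because `f` has good reduction, it maps residue discs onto residue discs, and on each
disc it is either isometric or strictly contracting, according to whether the Wronskian
`P' Q - P Q'` is a unit there or not (`IsLocalChart.exists_factor`). Since `deg f < p`, the
reduction of `f` is separable, so only finitely many discs are contracted; call these ramified
(`IsGoodModel.exists_finite_contracting`).

Two facts control the ramification in a step from `f x` to `x`. If the disc of `x` is not ramified,
then `f` is injective on it and inertia fixes `x` as soon as it fixes `f x`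
(`map_eq_of_isIsometricAt`). In general, a finite extension `L` can be replaced by a finite
extension `L'` such that `I_{L'}` fixes *all* the points `x` for which `I_L` fixes `f x`
(`exists_inertia_fixes_of_orbit_le`). The latter is the theory of tame ramification, in the
following form. The `I_L`-orbit of `x` has at most `deg f < p` elements. For `σ ∈ I_{L'}` let `t`
be the average of the `σ`-orbit of `x`. The value of `x - t` is, up to a factorial exponent, that of
an element of the maximal unramified extension of `L`, and such values already come from `L`
(`exists_mem_absVal_eq`). If `L'` contains a suitable root of `p`, it follows that
`v (σ z - z) < v z` for `z = x - t`; summing over the orbit, whose length is prime to `p`, one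
gets `z = 0`.

Now consider the vertices of the tree whose residue discs are periodic under `f`. If inertia fixes
all of them, then on the way from any vertex to the root a ramified disc that matters is not
periodic, hence is met only once; so the number of ramified steps is at most the number of ramified
discs, and one finite extension makes the whole arboreal representation unramified
(`IsGoodModel.exists_inertia_fixes`). Otherwise there are `σ` in the inertia group of `K` and a
vertex `x` in a periodic disc with `σ x ≠ x`. The orbit of `x` meets a ramified disc, so some
iterate `F` of `f` maps the disc of `x` onto itself and contracts it strictly. Choosing preimages
under `F` inside this disc gives a branch through points `γ_k` with `F γ_{k+1} = γ_k`, and the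
distances `ρ(γ_k, σ γ_k) ∈ (0, 1)` increase strictly with `k`. If the branch representation were
unramified over a finite extension of `K`, these distances would lie in the value group of its
maximal unramified extension, which is discrete: a contradiction (`IsGoodModel.exists_branch`).
-/

namespace Arboreal

open scoped NNReal

/-! ### The valuation of an algebraic extension of `ℚ_p` -/

section Valuation

variable (p : ℕ) [Fact p.Prime] (E : Type*) [Field E] [Algebra ℚ_[p] E]
  [Algebra.IsAlgebraic ℚ_[p] E]

/-- The unique extension to `E` of the absolute value of `ℚ_p`, as a (multiplicatively written)
valuation with values in `ℝ≥0`. -/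
noncomputable def absVal : Valuation E ℝ≥0 where
  toFun x := ⟨spectralNorm ℚ_[p] E x, spectralNorm_nonneg x⟩
  map_zero' := Subtype.ext spectralNorm_zero
  map_one' := Subtype.ext spectralNorm_one
  map_mul' x y := Subtype.ext <| by
    exact map_mul (spectralMulAlgNorm ℚ_[p] E) x y
  map_add_le_max' x y := isNonarchimedean_spectralNorm (K := ℚ_[p]) (L := E) x y

variable {E}

theorem coe_absVal (x : E) : (absVal p E x : ℝ) = spectralNorm ℚ_[p] E x := rfl

theorem mem_integers_iff {x : E} : x ∈ integers p E ↔ absVal p E x ≤ 1 := Iff.rfl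

theorem absVal_algebraMap (x : ℚ_[p]) : absVal p E (algebraMap ℚ_[p] E x) = ‖x‖₊ :=
  NNReal.eq (spectralNorm_extends x)

theorem absVal_natCast (n : ℕ) : absVal p E (n : E) = ‖(n : ℚ_[p])‖₊ := by
  rw [← absVal_algebraMap p (E := E), map_natCast (algebraMap ℚ_[p] E)]

theorem absVal_natCast_eq_one {n : ℕ} (hn : ¬ p ∣ n) : absVal p E (n : E) = 1 := by
  rw [absVal_natCast]
  refine NNReal.eq ?_
  simp only [coe_nnnorm, NNReal.coe_one]
  exact Padic.norm_natCast_eq_one_iff.mpr ((Nat.Prime.coprime_iff_not_dvd Fact.out).mpr hn)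

theorem absVal_prime : absVal p E (p : E) = (p : ℝ≥0)⁻¹ := by
  rw [absVal_natCast]
  refine NNReal.eq ?_
  simp

theorem absVal_algEquiv {F : Type*} [Field F] [Algebra ℚ_[p] F] [Algebra F E]
    [IsScalarTower ℚ_[p] F E] (σ : E ≃ₐ[F] E) (x : E) : absVal p E (σ x) = absVal p E x :=
  NNReal.eq (spectralNorm_eq_of_equiv (σ.restrictScalars ℚ_[p]) x).symm

theorem residue_eq_zero_iff (x : integers p E) :
    IsLocalRing.residue (integers p E) x = 0 ↔ absVal p E x < 1 := by
  rw [IsLocalRing.residue_eq_zero_iff, IsLocalRing.mem_maximalIdeal, mem_nonunits_iff, not_iff_comm,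
    not_lt]
  constructor
  · intro h
    have hx0 : (x : E) ≠ 0 := fun h0 => by simp [h0] at h
    have hi : (x : E)⁻¹ ∈ integers p E := by
      rw [mem_integers_iff, map_inv₀]
      exact inv_le_one_of_one_le₀ h
    exact IsUnit.of_mul_eq_one ⟨_, hi⟩ (Subtype.ext (mul_inv_cancel₀ hx0))
  · rintro ⟨u, rfl⟩
    have h1 : ((u : integers p E) : E) * ((u⁻¹ : (integers p E)ˣ) : integers p E) = 1 := by
      exact_mod_cast congrArg Subtype.val u.mul_inv
    have h2 := congrArg (absVal p E) h1
    rw [map_mul, map_one] at h2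
    by_contra! hlt
    have h3 := (mem_integers_iff p).mp ((u⁻¹ : (integers p E)ˣ) : integers p E).2
    exact absurd h2 (mul_lt_one_of_lt_of_le hlt h3).ne

theorem residue_eq_residue_iff (x y : integers p E) :
    IsLocalRing.residue (integers p E) x = IsLocalRing.residue (integers p E) y ↔
      absVal p E ((x : E) - y) < 1 := by
  rw [← sub_eq_zero, ← map_sub, residue_eq_zero_iff]
  rfl

open scoped Pointwise in
/-- Membership in the inertia subgroup, in terms of the absolute value. -/
theorem mem_inertia_iff {F : Type*} [Field F] [Algebra F E] {σ : E ≃ₐ[F] E}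
    (hinv : ∀ x, absVal p E (σ x) = absVal p E x) :
    σ ∈ ((integers p E).inertiaSubgroup F).map
      ((integers p E).decompositionSubgroup F).subtype ↔
      ∀ x : E, absVal p E x ≤ 1 → absVal p E (σ x - x) < 1 := by
  have hσ : σ ∈ (integers p E).decompositionSubgroup F := by
    rw [MulAction.mem_stabilizer_iff]
    ext x
    rw [ValuationSubring.mem_pointwise_smul_iff_inv_smul_mem, mem_integers_iff, mem_integers_iff]
    rw [← hinv, ← AlgEquiv.smul_def, smul_inv_smul]
  obtain ⟨τ, hτ⟩ : ∃ τ : (integers p E).decompositionSubgroup F, (τ : E ≃ₐ[F] E) = σ :=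
    ⟨⟨σ, hσ⟩, rfl⟩
  have hsmul : ∀ x : integers p E, ((τ • x : integers p E) : E) = σ x := fun x => by
    rw [← hτ]; rfl
  have key : τ ∈ (integers p E).inertiaSubgroup F ↔
      ∀ x : E, absVal p E x ≤ 1 → absVal p E (σ x - x) < 1 := by
    have h1 : τ ∈ (integers p E).inertiaSubgroup F ↔ ∀ y : IsLocalRing.ResidueField (integers p E),
        τ • y = y := by
      rw [ValuationSubring.inertiaSubgroup, MonoidHom.mem_ker, RingEquiv.ext_iff]
      rfl
    have h2 : ∀ x : integers p E, τ • IsLocalRing.residue (integers p E) x =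
        IsLocalRing.residue (integers p E) x ↔ absVal p E (σ x - x) < 1 := fun x => by
      rw [← IsLocalRing.ResidueField.residue_smul, residue_eq_residue_iff, hsmul]
    rw [h1]
    exact ⟨fun h x hx => (h2 ⟨x, hx⟩).mp (h _), fun h y => by
      obtain ⟨x, rfl⟩ := IsLocalRing.residue_surjective y
      exact (h2 x).mpr (h x x.2)⟩
  rw [← key]
  simp only [Subgroup.mem_map, Subgroup.coe_subtype]
  constructor
  · rintro ⟨τ', hτ', h⟩
    rwa [Subtype.ext (hτ.trans h.symm)]
  · exact fun h => ⟨_, h, hτ⟩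

end Valuation

/-! ### Inertia and unramified representations -/

section Inertia

variable (p : ℕ) [Fact p.Prime] {K : Type*} [Field K] [Algebra ℚ_[p] K]
  [Algebra.IsAlgebraic ℚ_[p] K]

/-- The inertia subgroup of `Gal(K̄/L)`, as a subgroup of `Gal(K̄/K)`: the automorphisms which
fix `L` and act trivially on residues. -/
noncomputable def inertia (L : IntermediateField K (AlgebraicClosure K)) :
    Subgroup (AlgebraicClosure K ≃ₐ[K] AlgebraicClosure K) where
  carrier := {σ | (∀ x ∈ L, σ x = x) ∧ ∀ x, absVal p (AlgebraicClosure K) x ≤ 1 →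
    absVal p (AlgebraicClosure K) (σ x - x) < 1}
  one_mem' := ⟨fun _ _ => rfl, fun x _ => by simp⟩
  mul_mem' {σ τ} hσ hτ := by
    refine ⟨fun x hx => ?_, fun x hx => ?_⟩
    · rw [AlgEquiv.mul_apply, hτ.1 x hx, hσ.1 x hx]
    · have h : (σ * τ) x - x = σ (τ x - x) + (σ x - x) := by
        rw [AlgEquiv.mul_apply, map_sub]; ring
      rw [h]
      refine Valuation.map_add_lt _ ?_ (hσ.2 x hx)
      rw [absVal_algEquiv]
      exact hτ.2 x hx
  inv_mem' {σ} hσ := by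
    have h1 : ∀ x, σ (σ⁻¹ x) = x := fun x => σ.apply_symm_apply x
    refine ⟨fun x hx => σ.injective ?_, fun x hx => ?_⟩
    · rw [h1, hσ.1 x hx]
    · rw [← absVal_algEquiv p σ, map_sub, h1, Valuation.map_sub_swap]
      exact hσ.2 x hx

theorem inertia_anti {L L' : IntermediateField K (AlgebraicClosure K)} (h : L ≤ L') :
    inertia p L' ≤ inertia p L :=
  fun _ hσ => ⟨fun x hx => hσ.1 x (h hx), hσ.2⟩

theorem isUnramified_restrict_iff {H : Type*} [Group H]
    (ρ : (AlgebraicClosure K ≃ₐ[K] AlgebraicClosure K) →* H)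
    (L : IntermediateField K (AlgebraicClosure K)) :
    IsUnramified p (F := L) (E := AlgebraicClosure K)
      (ρ.comp (AlgEquiv.restrictScalarsHom K :
        (AlgebraicClosure K ≃ₐ[L] AlgebraicClosure K) →*
          (AlgebraicClosure K ≃ₐ[K] AlgebraicClosure K))) ↔
      inertia p L ≤ ρ.ker := by
  constructor
  · intro h σ hσ
    let τ : AlgebraicClosure K ≃ₐ[L] AlgebraicClosure K :=
      { σ with commutes' := fun x => hσ.1 _ x.2 }
    exact h ((mem_inertia_iff p (σ := τ) fun x => absVal_algEquiv p σ x).mpr hσ.2)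
  · intro h σ hσ
    rw [mem_inertia_iff p (σ := σ)
      fun x => absVal_algEquiv p (AlgEquiv.restrictScalars K σ) x] at hσ
    exact h (show AlgEquiv.restrictScalars K σ ∈ inertia p L from
      ⟨fun x hx => σ.commutes ⟨x, hx⟩, hσ⟩)

theorem isInfinitelyRamified_iff {H : Type*} [Group H]
    (ρ : (AlgebraicClosure K ≃ₐ[K] AlgebraicClosure K) →* H) :
    IsInfinitelyRamified p ρ ↔
      ∀ L : IntermediateField K (AlgebraicClosure K), FiniteDimensional K L →
        ¬ inertia p L ≤ ρ.ker := by
  simp only [IsInfinitelyRamified, isUnramified_restrict_iff, not_exists, not_and]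

end Inertia

theorem mem_ker_treeRep {K E : Type*} [Field K] [Field E] [Algebra K E] {f : RatFunc K}
    {S : Set (ℕ × OnePoint E)} {hS : GaloisStable K S} {σ : E ≃ₐ[K] E} :
    σ ∈ (treeRep f S hS).ker ↔ ∀ v ∈ S, v.2.map σ = v.2 := by
  rw [MonoidHom.mem_ker]
  constructor
  · intro h v hv
    exact congrArg Prod.snd (congrArg Subtype.val (DFunLike.congr_fun h ⟨v, hv⟩))
  · intro h
    refine RelIso.ext fun v => Subtype.ext (Prod.ext rfl (h v.1 v.2))

/-! ### Roots of unity of order prime to `p` -/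

theorem _root_.Valuation.exists_root_map_sub_lt_one {E : Type*} [Field E] (v : Valuation E ℝ≥0)
    {g : E[X]} (hg : g.Splits) {x : E} {c : ℝ≥0} (hlt : v (g.eval x) < c)
    (hc : c ≤ v g.leadingCoeff) : ∃ r ∈ g.roots, v (x - r) < 1 := by
  by_contra! h
  rw [hg.eval_eq_prod_roots, map_mul, map_multiset_prod, Multiset.map_map] at hlt
  have h1 : 1 ≤ (Multiset.map (v ∘ fun r => x - r) g.roots).prod := by
    refine Multiset.one_le_prod fun y hy => ?_
    obtain ⟨r, hr, rfl⟩ := Multiset.mem_map.mp hy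
    exact h r hr
  exact absurd hlt (not_lt.mpr (hc.trans (le_mul_of_one_le_right zero_le h1)))

section PrimeToP

variable (p : ℕ) [Fact p.Prime] (E : Type*) [Field E]

/-- The group of roots of unity of order prime to `p`, as a submonoid. -/
def tameRoots : Submonoid E where
  carrier := {ζ | ∃ m : ℕ, ¬ p ∣ m ∧ ζ ^ m = 1}
  one_mem' := ⟨1, (Fact.out : p.Prime).not_dvd_one, one_pow 1⟩
  mul_mem' := by
    rintro x y ⟨m, hm, hx⟩ ⟨n, hn, hy⟩
    refine ⟨m * n, (Fact.out : p.Prime).not_dvd_mul hm hn, ?_⟩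
    rw [mul_pow, pow_mul, hx, one_pow, one_mul, mul_comm, pow_mul, hy, one_pow]

variable {E}

theorem inv_mem_tameRoots {ζ : E} (h : ζ ∈ tameRoots p E) : ζ⁻¹ ∈ tameRoots p E := by
  obtain ⟨m, hm, hζ⟩ := h
  exact ⟨m, hm, by rw [inv_pow, hζ, inv_one]⟩

variable [Algebra ℚ_[p] E] [Algebra.IsAlgebraic ℚ_[p] E]

theorem absVal_tameRoots {ζ : E} (h : ζ ∈ tameRoots p E) : absVal p E ζ = 1 := by
  obtain ⟨m, hm, hζ⟩ := h
  have h0 : m ≠ 0 := fun h0 => hm (h0 ▸ dvd_zero p)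
  refine (pow_eq_one_iff_of_nonneg zero_le h0).mp ?_
  rw [← map_pow, hζ, map_one]

/-- Roots of unity of order prime to `p` are determined by their residues. -/
theorem tameRoots_ext {ζ η : E} (hζ : ζ ∈ tameRoots p E) (hη : η ∈ tameRoots p E)
    (h : absVal p E (ζ - η) < 1) : ζ = η := by
  have hη0 : η ≠ 0 := fun h0 => by simpa [h0] using absVal_tameRoots p hη
  have hξ := (tameRoots p E).mul_mem hζ (inv_mem_tameRoots p hη)
  set ξ := ζ * η⁻¹ with hξ_def
  suffices ξ = 1 by rwa [hξ_def, mul_inv_eq_one₀ hη0] at this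
  have h1 : absVal p E (ξ - 1) < 1 := by
    have : ξ - 1 = (ζ - η) * η⁻¹ := by rw [sub_mul, mul_inv_cancel₀ hη0]
    rwa [this, map_mul, absVal_tameRoots p (inv_mem_tameRoots p hη), mul_one]
  obtain ⟨m, hm, hξm⟩ := hξ
  have hpow : ∀ i : ℕ, absVal p E (ξ ^ i - 1) < 1 := fun i => by
    rw [← mul_geom_sum ξ i, map_mul]
    refine mul_lt_one_of_lt_of_le h1 ?_
    refine Valuation.map_sum_le _ fun j _ => ?_
    rw [map_pow, absVal_tameRoots p ⟨m, hm, hξm⟩, one_pow]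
  have hsum : absVal p E (∑ i ∈ Finset.range m, ξ ^ i) = 1 := by
    have h2 : ∑ i ∈ Finset.range m, ξ ^ i = ∑ i ∈ Finset.range m, (ξ ^ i - 1) + (m : E) := by
      simp
    rw [h2, Valuation.map_add_eq_of_lt_right, absVal_natCast_eq_one p hm]
    rw [absVal_natCast_eq_one p hm]
    exact Valuation.map_sum_lt _ one_ne_zero fun i _ => hpow i
  have h3 := mul_geom_sum ξ m
  rw [hξm, sub_self, mul_eq_zero] at h3
  rcases h3 with h3 | h3
  · exact sub_eq_zero.mp h3
  · simp [h3] at hsum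

/-- The residue field of an algebraic extension of `ℚ_p` is algebraic over the prime field. -/
theorem isIntegral_residue (x : integers p E) :
    IsIntegral ℤ (IsLocalRing.residue (integers p E) x) := by
  set g := minpoly ℚ_[p] (x : E)
  have hg : g.Monic := minpoly.monic (Algebra.IsIntegral.isIntegral _)
  have hcoeff : ∀ n, ‖g.coeff n‖ ≤ 1 := (spectralValue_le_one_iff hg).mp x.2
  have hlift : ∀ n, ∃ c : ℕ, ‖g.coeff n - c‖ < 1 := fun n => by
    obtain ⟨z, hz⟩ : ∃ z : ℤ_[p], (z : ℚ_[p]) = g.coeff n := ⟨⟨_, hcoeff n⟩, rfl⟩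
    obtain ⟨c, -, hc⟩ := PadicInt.exists_mem_range z
    rw [IsLocalRing.mem_maximalIdeal, PadicInt.mem_nonunits, PadicInt.norm_def,
      PadicInt.coe_sub, PadicInt.coe_natCast, hz] at hc
    exact ⟨c, hc⟩
  choose c hc using hlift
  refine ⟨X ^ g.natDegree + ∑ i ∈ Finset.range g.natDegree, C (c i : ℤ) * X ^ i,
    monic_X_pow_add ?_, ?_⟩
  · refine (degree_sum_le _ _).trans_lt ((Finset.sup_lt_iff (WithBot.bot_lt_coe _)).mpr ?_)
    intro i hi
    exact (degree_C_mul_X_pow_le _ _).trans_lt (by exact_mod_cast Finset.mem_range.mp hi)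
  · have hroot : (x : E) ^ g.natDegree +
        ∑ i ∈ Finset.range g.natDegree, algebraMap ℚ_[p] E (g.coeff i) * (x : E) ^ i = 0 := by
      have h := minpoly.aeval ℚ_[p] (x : E)
      rw [aeval_eq_sum_range, Finset.sum_range_succ] at h
      rw [← h, add_comm]
      congr 1
      · exact Finset.sum_congr rfl fun i _ => (Algebra.smul_def _ _).symm
      · rw [hg.coeff_natDegree, one_smul]
    have hval : absVal p E ((x : E) ^ g.natDegree +
        ∑ i ∈ Finset.range g.natDegree, (c i : E) * (x : E) ^ i) < 1 := by
      rw [← sub_zero (_ + _), ← hroot, add_sub_add_left_eq_sub, ← Finset.sum_sub_distrib]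
      refine Valuation.map_sum_lt _ one_ne_zero fun i _ => ?_
      rw [← sub_mul, map_mul]
      refine mul_lt_one_of_lt_of_le ?_ ?_
      · rw [← map_natCast (algebraMap ℚ_[p] E), ← map_sub, absVal_algebraMap, ← nnnorm_neg, neg_sub]
        exact_mod_cast hc i
      · rw [map_pow]
        exact pow_le_one₀ zero_le x.2
    have h2 : IsLocalRing.residue (integers p E)
        (x ^ g.natDegree + ∑ i ∈ Finset.range g.natDegree, (c i : integers p E) * x ^ i) = 0 := by
      rw [residue_eq_zero_iff]
      simpa using hval
    simpa [eval₂_finsetSum] using h2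

instance charP_residue : CharP (IsLocalRing.ResidueField (integers p E)) p := by
  refine (CharP.charP_iff_prime_eq_zero Fact.out).mpr ?_
  rw [← map_natCast (IsLocalRing.residue (integers p E)), residue_eq_zero_iff]
  have h := absVal_prime p (E := E)
  have h1 : (1 : ℝ≥0) < p := by exact_mod_cast (Fact.out : p.Prime).one_lt
  have h2 : ((p : integers p E) : E) = p := by simp
  rw [h2, h]
  exact inv_lt_one_of_one_lt₀ h1

/-- The roots of unity of order prime to `p` represent all nonzero residues. -/
theorem exists_tameRoots_sub_lt_one [IsAlgClosed E] {x : E} (hx : absVal p E x = 1) :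
    ∃ ζ ∈ tameRoots p E, absVal p E (x - ζ) < 1 := by
  set k := IsLocalRing.ResidueField (integers p E)
  set y : k := IsLocalRing.residue (integers p E) ⟨x, hx.le⟩ with hy
  obtain ⟨m, hm, hpow⟩ : ∃ m : ℕ, ¬ p ∣ m ∧ y ^ m = 1 := by
    let : Algebra (ZMod p) k := ZMod.algebra k p
    have hint : IsIntegral (ZMod p) y := by
      obtain ⟨h, hmon, hroot⟩ := isIntegral_residue p (⟨x, hx.le⟩ : integers p E)
      refine ⟨h.map (Int.castRingHom (ZMod p)), hmon.map _, ?_⟩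
      rwa [eval₂_map, Subsingleton.elim ((algebraMap (ZMod p) k).comp _) (algebraMap ℤ k)]
    let F := IntermediateField.adjoin (ZMod p) {y}
    have : FiniteDimensional (ZMod p) F := IntermediateField.adjoin.finiteDimensional hint
    have : Finite F := Module.finite_of_finite (ZMod p)
    let : Fintype F := Fintype.ofFinite F
    have : CharP F p := charP_of_injective_algebraMap (algebraMap (ZMod p) F).injective p
    obtain ⟨n, -, hcard⟩ := FiniteField.card F p
    have hy0 : y ≠ 0 := by
      rw [hy, Ne, residue_eq_zero_iff, not_lt]
      exact hx.ge
    refine ⟨Fintype.card F - 1, ?_, ?_⟩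
    · intro hdvd
      have h1 : p ∣ Fintype.card F := hcard ▸ dvd_pow_self p n.ne_zero
      have h2 : 1 ≤ Fintype.card F := Fintype.card_pos
      exact (Fact.out : p.Prime).not_dvd_one ((Nat.dvd_sub_iff_right h2 h1).mp hdvd)
    · have h := FiniteField.pow_card_sub_one_eq_one
        (⟨y, IntermediateField.mem_adjoin_simple_self _ y⟩ : F)
        (fun h => hy0 (congrArg Subtype.val h))
      exact congrArg Subtype.val h
  have hm0 : m ≠ 0 := fun h0 => hm (h0 ▸ dvd_zero p)
  have hlt : absVal p E ((X ^ m - 1 : E[X]).eval x) < 1 := by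
    rw [hy, ← map_pow, ← map_one (IsLocalRing.residue (integers p E)),
      residue_eq_residue_iff] at hpow
    simpa using hpow
  have hmonic : (X ^ m - 1 : E[X]).Monic := monic_X_pow_sub_C 1 hm0
  obtain ⟨ζ, hζ, hlt⟩ := (absVal p E).exists_root_map_sub_lt_one
    (IsAlgClosed.splits (X ^ m - 1)) hlt (by rw [hmonic.leadingCoeff, map_one])
  refine ⟨ζ, ⟨m, hm, ?_⟩, hlt⟩
  have := (mem_roots'.mp hζ).2
  simpa [sub_eq_zero] using this

end PrimeToP

/-! ### The value group of the maximal unramified extension -/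

section Trace

variable (p : ℕ) [Fact p.Prime] {L E : Type*} [Field L] [Field E] [Algebra L E]
  [Algebra ℚ_[p] E] [Algebra.IsAlgebraic ℚ_[p] E]

/-- An extension `F` of `L` generated by roots of unity of order prime to `p` has the same value
group as `L`: distinct automorphisms of `F` induce distinct residue characters on these roots of
unity, so by Dedekind's independence of characters some multiple `w ζ` of a given `w` by such a
root of unity has a trace of the same absolute value as `w`. -/
theorem exists_absVal_eq_of_isGalois {F : Type*} [Field F] [Algebra L F] [Algebra F E]
    [IsScalarTower L F E] [FiniteDimensional L F] [IsGalois L F] [Normal L E]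
    (hinv : ∀ (σ : E ≃ₐ[L] E) (x : E), absVal p E (σ x) = absVal p E x)
    (hgen : ∀ σ τ : F ≃ₐ[L] F,
      (∀ ζ, algebraMap F E ζ ∈ tameRoots p E → σ ζ = τ ζ) → σ = τ) {w : F} (hw0 : w ≠ 0) :
    ∃ l : L, absVal p E (algebraMap L E l) = absVal p E (algebraMap F E w) := by
  obtain ⟨v, hvE⟩ : ∃ v : Valuation F ℝ≥0, ∀ x, v x = absVal p E (algebraMap F E x) :=
    ⟨(absVal p E).comap (algebraMap F E), fun _ => rfl⟩
  have hv : ∀ (σ : F ≃ₐ[L] F) (x : F), v (σ x) = v x := fun σ x => by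
    rw [hvE, hvE, ← AlgEquiv.liftNormal_commutes σ E x, hinv]
  -- the action of `σ` on residues, restricted to roots of unity
  let M : Submonoid F := (tameRoots p E).comap (algebraMap F E)
  have hM : ∀ (σ : F ≃ₐ[L] F) (ζ : M), algebraMap F E (σ ζ) ∈
      tameRoots p E := fun σ ζ => by
    obtain ⟨n, hn, hζ⟩ := ζ.2
    exact ⟨n, hn, by rw [← map_pow, ← map_pow, (algebraMap F E).injective
      (by rw [map_pow, hζ, map_one] : algebraMap F E ((ζ : F) ^ n) =
        algebraMap F E 1), map_one, map_one]⟩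
  let O := integers p E
  let χ : (F ≃ₐ[L] F) → M →* IsLocalRing.ResidueField O := fun σ =>
    { toFun := fun ζ => IsLocalRing.residue O
        ⟨algebraMap F E (σ ζ), (absVal_tameRoots p (hM σ ζ)).le⟩
      map_one' := by
        rw [← map_one (IsLocalRing.residue O)]
        congr 1
        exact Subtype.ext (by simp)
      map_mul' := fun ζ η => by
        rw [← map_mul (IsLocalRing.residue O)]
        congr 1
        exact Subtype.ext (by simp) }
  have hχ_apply : ∀ σ (ζ : M), χ σ ζ = IsLocalRing.residue O
      ⟨algebraMap F E (σ ζ), (absVal_tameRoots p (hM σ ζ)).le⟩ := fun _ _ => rfl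
  have hχ : Function.Injective χ := by
    intro σ τ h
    refine hgen σ τ fun ζ hζ => (algebraMap F E).injective ?_
    have h1 := DFunLike.congr_fun h ⟨ζ, hζ⟩
    rw [hχ_apply, hχ_apply, residue_eq_residue_iff] at h1
    exact tameRoots_ext p (hM σ ⟨ζ, hζ⟩) (hM τ ⟨ζ, hζ⟩) h1
  have hindep := (linearIndependent_monoidHom M (IsLocalRing.ResidueField O)).comp χ hχ
  have hunit : ∀ σ : F ≃ₐ[L] F, v (σ w / w) = 1 := fun σ => by
    rw [map_div₀, hv, div_self ((Valuation.ne_zero_iff _).mpr hw0)]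
  let c : (F ≃ₐ[L] F) → O := fun σ => ⟨algebraMap F E (σ w / w), (hvE _ ▸ hunit σ).le⟩
  obtain ⟨ζ, hζ⟩ : ∃ ζ : M, ∑ σ, IsLocalRing.residue O (c σ) * χ σ ζ ≠ 0 := by
    by_contra! h
    have h1 := Fintype.linearIndependent_iff.mp hindep
      (fun σ => IsLocalRing.residue O (c σ)) (funext fun ζ => by simpa using h ζ) 1
    rw [residue_eq_zero_iff] at h1
    exact absurd (hvE _ ▸ hunit 1) h1.ne
  let l : F := ∑ σ : F ≃ₐ[L] F, σ (w * ζ)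
  have hl : l = w * ∑ σ : F ≃ₐ[L] F, σ w / w * σ ζ := by
    rw [Finset.mul_sum]
    refine Finset.sum_congr rfl fun σ _ => ?_
    rw [map_mul]
    field_simp
  have hval : v (∑ σ : F ≃ₐ[L] F, σ w / w * σ ζ) = 1 := by
    refine le_antisymm (Valuation.map_sum_le _ fun σ _ => ?_) ?_
    · rw [map_mul, hunit, one_mul]
      exact (hvE _).trans_le (absVal_tameRoots p (hM σ ζ)).le
    · have h1 : IsLocalRing.residue O
          (∑ σ, c σ * ⟨algebraMap F E (σ ζ),
            (absVal_tameRoots p (hM σ ζ)).le⟩) ≠ 0 := by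
        rw [map_sum]
        simpa only [map_mul, hχ_apply] using hζ
      rw [Ne, residue_eq_zero_iff, not_lt] at h1
      refine h1.trans_eq ?_
      rw [hvE]
      congr 1
      simp [c]
  have hlbot : l ∈ (⊥ : IntermediateField L F) := by
    rw [IsGalois.mem_bot_iff_fixed]
    intro τ
    simp only [l, map_sum]
    exact Fintype.sum_equiv (Equiv.mulLeft τ) _ _ fun σ => rfl
  obtain ⟨l', hl'⟩ := IntermediateField.mem_bot.mp hlbot
  refine ⟨l', ?_⟩
  rw [IsScalarTower.algebraMap_apply L F E, hl', ← hvE, ← hvE, hl, map_mul, hval, mul_one]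

end Trace

section Unramified

variable (p : ℕ) [Fact p.Prime] {K : Type*} [Field K] [Algebra ℚ_[p] K]
  [Algebra.IsAlgebraic ℚ_[p] K]

theorem absVal_algEquiv_intermediateField {L : IntermediateField K (AlgebraicClosure K)}
    (σ : AlgebraicClosure K ≃ₐ[L] AlgebraicClosure K) (x : AlgebraicClosure K) :
    absVal p _ (σ x) = absVal p _ x :=
  absVal_algEquiv p (σ.restrictScalars K) x

/-- Automorphisms fixing the roots of unity of order prime to `p` act trivially on residues. -/
theorem mem_inertia_of_fixes_tameRoots {L : IntermediateField K (AlgebraicClosure K)}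
    {σ : AlgebraicClosure K ≃ₐ[K] AlgebraicClosure K} (hL : ∀ x ∈ L, σ x = x)
    (hσ : ∀ ζ ∈ tameRoots p (AlgebraicClosure K), σ ζ = ζ) : σ ∈ inertia p L := by
  refine ⟨hL, fun x hx => ?_⟩
  rcases hx.lt_or_eq with hx | hx
  · exact (Valuation.map_sub _ _ _).trans_lt (max_lt (by rwa [absVal_algEquiv]) hx)
  · obtain ⟨ζ, hζ, hlt⟩ := exists_tameRoots_sub_lt_one p hx
    have h : σ x - x = σ (x - ζ) - (x - ζ) := by rw [map_sub, hσ ζ hζ]; ring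
    rw [h]
    exact (Valuation.map_sub _ _ _).trans_lt (max_lt (by rwa [absVal_algEquiv]) hlt)

/-- The fixed field of inertia over `L` is generated by the roots of unity of order prime
to `p`. -/
theorem mem_adjoin_tameRoots {L : IntermediateField K (AlgebraicClosure K)}
    {w : AlgebraicClosure K} (hw : ∀ σ ∈ inertia p L, σ w = w) :
    w ∈ IntermediateField.adjoin L
      (tameRoots p (AlgebraicClosure K) : Set (AlgebraicClosure K)) := by
  have : CharZero K := charZero_of_injective_algebraMap (algebraMap ℚ_[p] K).injective
  rw [← InfiniteGalois.fixedField_fixingSubgroup (IntermediateField.adjoin L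
    (tameRoots p (AlgebraicClosure K) : Set (AlgebraicClosure K)))]
  rintro ⟨σ, hσ⟩
  refine hw (σ.restrictScalars K) (mem_inertia_of_fixes_tameRoots p
    (fun x hx => σ.commutes ⟨x, hx⟩) fun ζ hζ => ?_)
  exact hσ ⟨ζ, IntermediateField.subset_adjoin _ _ hζ⟩

theorem exists_mem_adjoin_rootSet {L : IntermediateField K (AlgebraicClosure K)}
    {w : AlgebraicClosure K} (hw : ∀ σ ∈ inertia p L, σ w = w) :
    ∃ m : ℕ, ¬ p ∣ m ∧
      w ∈ IntermediateField.adjoin L ((X ^ m - 1 : L[X]).rootSet (AlgebraicClosure K)) := by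
  obtain ⟨T, hT, hwT⟩ := IntermediateField.exists_finset_of_mem_adjoin (mem_adjoin_tameRoots p hw)
  have hT' : ∀ ζ : T, ∃ m : ℕ, ¬ p ∣ m ∧ (ζ : AlgebraicClosure K) ^ m = 1 := fun ζ => hT ζ.2
  choose m hm hζ using hT'
  have hprod : ¬ p ∣ ∏ ζ, m ζ := by
    rw [Prime.dvd_finsetProd_iff (Fact.out : p.Prime).prime]
    rintro ⟨ζ, -, h⟩
    exact hm ζ h
  refine ⟨_, hprod, IntermediateField.adjoin.mono _ _ _ ?_ hwT⟩
  intro ζ hζT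
  have h0 : ∏ ζ, m ζ ≠ 0 := fun h0 => hprod (h0 ▸ dvd_zero p)
  rw [mem_rootSet]
  refine ⟨(monic_X_pow_sub_C 1 h0).ne_zero, ?_⟩
  obtain ⟨c, hc⟩ := Finset.dvd_prod_of_mem m (Finset.mem_univ (⟨ζ, hζT⟩ : T))
  have := hζ ⟨ζ, hζT⟩
  simp only at this
  rw [map_sub, map_pow, aeval_X, map_one, hc, pow_mul, this, one_pow, sub_self]

/-- The maximal unramified extension of `L` has the same value group as `L`. -/
theorem exists_mem_absVal_eq {L : IntermediateField K (AlgebraicClosure K)}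
    {w : AlgebraicClosure K} (hw : ∀ σ ∈ inertia p L, σ w = w) :
    ∃ l ∈ L, absVal p (AlgebraicClosure K) l = absVal p (AlgebraicClosure K) w := by
  have : CharZero K := charZero_of_injective_algebraMap (algebraMap ℚ_[p] K).injective
  rcases eq_or_ne w 0 with rfl | hw0
  · exact ⟨0, zero_mem L, rfl⟩
  obtain ⟨m, hm, hwF⟩ := exists_mem_adjoin_rootSet p hw
  generalize hg : (X ^ m - 1 : L[X]) = g at hwF
  generalize hF : IntermediateField.adjoin L (g.rootSet (AlgebraicClosure K)) = F at hwF
  have hsplit : IsSplittingField L F g :=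
    hF ▸ IntermediateField.adjoin_rootSet_isSplittingField (IsAlgClosed.splits _)
  have : Normal L F := Normal.of_isSplittingField g
  have : FiniteDimensional L F := IsSplittingField.finiteDimensional F g
  have : IsGalois L F := ⟨⟩
  have hgen : ∀ σ τ : F ≃ₐ[L] F, (∀ ζ, algebraMap F (AlgebraicClosure K) ζ ∈
      tameRoots p (AlgebraicClosure K) → σ ζ = τ ζ) → σ = τ := fun σ τ h => by
    refine AlgEquiv.coe_toAlgHom_injective ?_
    refine IntermediateField.algHom_ext_of_eq_adjoin L hF.symm (φ₁ := (σ : F →ₐ[L] F))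
      (φ₂ := (τ : F →ₐ[L] F)) fun x hx => h _ ⟨m, hm, ?_⟩
    have := (mem_rootSet.mp hx).2
    rw [← hg] at this
    simpa [sub_eq_zero] using this
  obtain ⟨l, hl⟩ := exists_absVal_eq_of_isGalois p (absVal_algEquiv_intermediateField p) hgen
    (w := ⟨w, hwF⟩) fun h => hw0 (congrArg Subtype.val h)
  exact ⟨l, l.2, hl⟩

/-- The value group of the maximal unramified extension of a finite extension `L` is discrete. The
exponent `M = [L : ℚ_p]` works because `|l|` raised to the degree of `l` is the absolute value of
the constant coefficient of the minimal polynomial of `l`. -/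
theorem exists_absVal_pow_eq_zpow [FiniteDimensional ℚ_[p] K]
    (L : IntermediateField K (AlgebraicClosure K)) [FiniteDimensional K L] :
    ∃ M : ℕ, M ≠ 0 ∧ ∀ w : AlgebraicClosure K, w ≠ 0 → (∀ σ ∈ inertia p L, σ w = w) →
      ∃ j : ℤ, absVal p (AlgebraicClosure K) w ^ M = (p : ℝ≥0) ^ j := by
  have : FiniteDimensional ℚ_[p] L := Module.Finite.trans K L
  refine ⟨Module.finrank ℚ_[p] L, Module.finrank_pos.ne', fun w hw0 hw => ?_⟩
  obtain ⟨l, hlL, hl⟩ := exists_mem_absVal_eq p hw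
  rw [← hl]
  have hl0 : l ≠ 0 := by
    rw [← Valuation.ne_zero_iff (absVal p (AlgebraicClosure K)), hl]
    exact (Valuation.ne_zero_iff _).mpr hw0
  have hint : IsIntegral ℚ_[p] l := Algebra.IsIntegral.isIntegral l
  obtain ⟨k, hk⟩ : (minpoly ℚ_[p] l).natDegree ∣ Module.finrank ℚ_[p] L := by
    let l' : L := ⟨l, hlL⟩
    have : minpoly ℚ_[p] l = minpoly ℚ_[p] l' := by
      have hinj : Function.Injective ((L.val).restrictScalars ℚ_[p]) := L.val.injective
      exact minpoly.algHom_eq ((L.val).restrictScalars ℚ_[p]) hinj l'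
    rw [this]
    exact minpoly.degree_dvd (Algebra.IsIntegral.isIntegral l')
  set c := (minpoly ℚ_[p] l).coeff 0
  have hc0 : c ≠ 0 := minpoly.coeff_zero_ne_zero hint hl0
  refine ⟨-c.valuation * k, NNReal.eq ?_⟩
  rw [hk, pow_mul, NNReal.coe_pow, NNReal.coe_pow, coe_absVal,
    spectralNorm.spectralNorm_eq_norm_coeff_zero_rpow,
    ← Real.rpow_natCast _ (minpoly ℚ_[p] l).natDegree, ← Real.rpow_mul (norm_nonneg _), one_div,
    inv_mul_cancel₀, Real.rpow_one, Padic.norm_eq_zpow_neg_valuation hc0]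
  · push_cast
    rw [zpow_mul, zpow_natCast]
  · exact_mod_cast (minpoly.natDegree_pos hint).ne'

end Unramified

/-! ### Tame ramification of bounded index -/

section Orbits

open MulAction in
/-- If an element is fixed by the pointwise stabilizer of a finite orbit of size at most `d`,
then the size of its own orbit divides `d!`. -/
theorem ncard_orbit_dvd_factorial {G X : Type*} [Group G] [MulAction G X] {d : ℕ} {x z : X}
    (hfin : (orbit G x).Finite) (hcard : (orbit G x).ncard ≤ d)
    (hz : ∀ g : G, (∀ y ∈ orbit G x, g • y = y) → g • z = z) :
    (orbit G z).ncard ∣ d.factorial := by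
  have : Finite (orbit G x) := hfin
  rw [← index_stabilizer]
  have h1 : (toPermHom G (orbit G x)).ker ≤ stabilizer G z := by
    intro g hg
    refine hz g fun y hy => ?_
    exact congrArg Subtype.val (DFunLike.congr_fun (MonoidHom.mem_ker.mp hg) ⟨y, hy⟩)
  refine (Subgroup.index_dvd_of_le h1).trans ?_
  rw [Subgroup.index_ker]
  refine (Subgroup.card_subgroup_dvd_card _).trans ?_
  rw [Nat.card_perm]
  exact Nat.factorial_dvd_factorial hcard

end Orbits

section Tame

variable (p : ℕ) [Fact p.Prime] {K : Type*} [Field K] [Algebra ℚ_[p] K]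
  [Algebra.IsAlgebraic ℚ_[p] K]

open MulAction in
/-- Some power of the absolute value of `z`, with exponent the size of its orbit under inertia, is
the absolute value of an element fixed by inertia, namely of the product of the orbit. -/
theorem exists_absVal_pow_eq_of_orbit {L : IntermediateField K (AlgebraicClosure K)}
    {z : AlgebraicClosure K} (hz : z ≠ 0) (hfin : (orbit (inertia p L) z).Finite) :
    ∃ w : AlgebraicClosure K, w ≠ 0 ∧ (∀ σ ∈ inertia p L, σ w = w) ∧
      absVal p _ w = absVal p _ z ^ (orbit (inertia p L) z).ncard := by
  refine ⟨∏ y ∈ hfin.toFinset, y, ?_, fun σ hσ => ?_, ?_⟩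
  · rw [Finset.prod_ne_zero_iff]
    intro y hy
    obtain ⟨τ, rfl⟩ := hfin.mem_toFinset.mp hy
    exact (map_ne_zero_iff _ τ.1.injective).mpr hz
  · rw [map_prod]
    refine Finset.prod_nbij σ (fun y hy => ?_) σ.injective.injOn (fun y hy => ?_) fun _ _ => rfl
    · rw [hfin.mem_toFinset] at hy ⊢
      exact mem_orbit_of_mem_orbit (⟨σ, hσ⟩ : inertia p L) hy
    · rw [Finset.mem_coe, hfin.mem_toFinset] at hy
      refine ⟨σ⁻¹ y, ?_, σ.apply_symm_apply y⟩
      rw [Finset.mem_coe, hfin.mem_toFinset]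
      exact mem_orbit_of_mem_orbit (⟨σ⁻¹, inv_mem hσ⟩ : inertia p L) hy
  · rw [map_prod, Finset.prod_congr rfl (g := fun _ => absVal p _ z), Finset.prod_const,
      Set.ncard_eq_toFinset_card _ hfin]
    intro y hy
    obtain ⟨τ, rfl⟩ := hfin.mem_toFinset.mp hy
    exact absVal_algEquiv p τ.1 z

/-- If the absolute value of `z` is attained in `L`, then `σ z / z` has residue `1` for all `σ` in
the inertia group of `L`. -/
theorem absVal_sub_lt_of_absVal_eq {L : IntermediateField K (AlgebraicClosure K)}
    {σ : AlgebraicClosure K ≃ₐ[K] AlgebraicClosure K} (hσ : σ ∈ inertia p L)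
    {z l : AlgebraicClosure K} (hl : l ∈ L) (hz : z ≠ 0) (hzl : absVal p _ z = absVal p _ l) :
    absVal p _ (σ z - z) < absVal p _ z := by
  have hz' : 0 < absVal p _ z := zero_lt_iff.mpr ((Valuation.ne_zero_iff _).mpr hz)
  have hl0 : l ≠ 0 := by
    rintro rfl
    exact hz'.ne' (by rw [hzl, map_zero])
  have h1 : σ z - z = l * (σ (z / l) - z / l) := by
    rw [map_div₀, hσ.1 l hl]
    field_simp
  rw [h1, map_mul, ← hzl]
  refine mul_lt_of_lt_one_right hz' (hσ.2 _ ?_)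
  rw [map_div₀, hzl, div_self (by rw [← hzl]; exact hz'.ne')]

/-- Averaging: if `σ` lies in the inertia group of `L` and `x` has period `m` prime to `p`
under `σ`, with average `t`, and `x - t` has the absolute value of an element of `L` (or is zero),
then `x` is fixed by `σ`. -/
theorem eq_of_average {L : IntermediateField K (AlgebraicClosure K)}
    {σ : AlgebraicClosure K ≃ₐ[K] AlgebraicClosure K} (hσ : σ ∈ inertia p L)
    {x : AlgebraicClosure K} {m : ℕ} (hm : ¬ p ∣ m) (hx : (σ ^ m) x = x)
    (hval : x - (m : AlgebraicClosure K)⁻¹ * ∑ i ∈ Finset.range m, (σ ^ i) x ≠ 0 → ∃ l ∈ L,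
      absVal p _ (x - (m : AlgebraicClosure K)⁻¹ * ∑ i ∈ Finset.range m, (σ ^ i) x) =
        absVal p _ l) :
    σ x = x := by
  have hm1 := absVal_natCast_eq_one p hm (E := AlgebraicClosure K)
  have hm0 : (m : AlgebraicClosure K) ≠ 0 := fun h => by simp [h] at hm1
  set t := (m : AlgebraicClosure K)⁻¹ * ∑ i ∈ Finset.range m, (σ ^ i) x with ht
  have hσt : σ t = t := by
    rw [ht, map_mul, map_inv₀, map_natCast, map_sum]
    congr 1
    have h1 := Finset.sum_range_succ (fun i => (σ ^ i) x) m
    rw [Finset.sum_range_succ', hx, pow_zero, AlgEquiv.one_apply] at h1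
    rw [← add_right_cancel h1]
    exact Finset.sum_congr rfl fun i _ => by rw [pow_succ', AlgEquiv.mul_apply]
  have hσt' : ∀ i : ℕ, (σ ^ i) t = t := fun i => by
    induction i with
    | zero => rfl
    | succ i ih => rw [pow_succ, AlgEquiv.mul_apply, hσt, ih]
  by_cases hz : x - t = 0
  · rw [sub_eq_zero.mp hz, hσt]
  exfalso
  obtain ⟨l, hl, hzl⟩ := hval hz
  have hsum : ∑ i ∈ Finset.range m, (σ ^ i) (x - t) = 0 := by
    simp only [map_sub, hσt', Finset.sum_sub_distrib, Finset.sum_const, Finset.card_range,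
      nsmul_eq_mul]
    rw [ht, mul_inv_cancel_left₀ hm0, sub_self]
  have h1 : absVal p _ (∑ i ∈ Finset.range m, ((σ ^ i) (x - t) - (x - t))) <
      absVal p _ (x - t) :=
    Valuation.map_sum_lt _ ((Valuation.ne_zero_iff _).mpr hz) fun i _ =>
      absVal_sub_lt_of_absVal_eq p (pow_mem hσ i) hl hz hzl
  rw [Finset.sum_sub_distrib, hsum, zero_sub, Valuation.map_neg, Finset.sum_const,
    Finset.card_range, nsmul_eq_mul, map_mul, hm1, one_mul] at h1
  exact h1.false

open MulAction in
/-- Tame ramification of index at most `d < p` is killed by a finite extension which depends only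
on `d` and on the base. -/
theorem exists_inertia_fixes_of_orbit_le [FiniteDimensional ℚ_[p] K] {d : ℕ} (hd : d < p)
    (L : IntermediateField K (AlgebraicClosure K)) [FiniteDimensional K L] :
    ∃ L' : IntermediateField K (AlgebraicClosure K), L ≤ L' ∧ FiniteDimensional K L' ∧
      ∀ (x : AlgebraicClosure K) (S : Set (AlgebraicClosure K)), S.Finite → S.ncard ≤ d →
        (∀ σ ∈ inertia p L, σ x ∈ S) → ∀ σ ∈ inertia p L', σ x = x := by
  obtain ⟨M, hM0, hM⟩ := exists_absVal_pow_eq_zpow p L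
  obtain ⟨ϖ, hϖ⟩ := IsAlgClosed.exists_pow_nat_eq (p : AlgebraicClosure K)
    (Nat.mul_pos d.factorial_pos (Nat.pos_of_ne_zero hM0))
  have : FiniteDimensional K (IntermediateField.adjoin K {ϖ}) :=
    IntermediateField.adjoin.finiteDimensional (Algebra.IsIntegral.isIntegral ϖ)
  refine ⟨L ⊔ IntermediateField.adjoin K {ϖ}, le_sup_left,
    IntermediateField.finiteDimensional_sup _ _, fun x S hSfin hS hxS σ hσ => ?_⟩
  have hσL := inertia_anti p le_sup_left hσ
  have hsub : orbit (inertia p L) x ⊆ S := by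
    rintro _ ⟨τ, rfl⟩
    exact hxS τ.1 τ.2
  have hfin : (orbit (inertia p L) x).Finite := hSfin.subset hsub
  have hcard : (orbit (inertia p L) x).ncard ≤ d := (Set.ncard_le_ncard hsub hSfin).trans hS
  have horb : ∀ i : ℕ, (σ ^ i) x ∈ orbit (inertia p L) x := fun i =>
    ⟨⟨σ ^ i, pow_mem hσL i⟩, rfl⟩
  obtain ⟨m, hm0, hmd, hm⟩ : ∃ m : ℕ, m ≠ 0 ∧ m ≤ d ∧ (σ ^ m) x = x := by
    have hlt : hfin.toFinset.card < (Finset.range (d + 1)).card := by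
      rw [Finset.card_range, ← Set.ncard_eq_toFinset_card _ hfin]
      omega
    obtain ⟨i, hi, j, hj, hij, h⟩ := Finset.exists_ne_map_eq_of_card_lt_of_maps_to hlt
      (f := fun i => (σ ^ i) x) fun i _ => by
        rw [Finset.mem_coe, hfin.mem_toFinset]; exact horb i
    wlog hlt : i < j generalizing i j
    · exact this j hj i hi hij.symm h.symm (by omega)
    rw [Finset.mem_range] at hi hj
    refine ⟨j - i, by omega, by omega, (σ ^ i).injective ?_⟩
    rw [← AlgEquiv.mul_apply, ← pow_add, Nat.add_sub_cancel' hlt.le]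
    exact h.symm
  refine eq_of_average p hσ (fun hdvd => ?_) hm fun hz => ?_
  · have := Nat.le_of_dvd (Nat.pos_of_ne_zero hm0) hdvd
    omega
  set z := x - (m : AlgebraicClosure K)⁻¹ * ∑ i ∈ Finset.range m, (σ ^ i) x with hz_def
  obtain ⟨c, hc⟩ := ncard_orbit_dvd_factorial (z := z) hfin hcard fun τ hτ => by
    change τ.1 z = z
    have h : ∀ i : ℕ, τ.1 ((σ ^ i) x) = (σ ^ i) x := fun i => hτ _ (horb i)
    have h0 : τ.1 x = x := h 0
    rw [hz_def, map_sub, map_mul, map_inv₀, map_natCast, map_sum, h0]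
    simp only [h]
  have hfinz : (orbit (inertia p L) z).Finite := by
    refine Set.finite_of_ncard_ne_zero fun h0 => ?_
    rw [h0, zero_mul] at hc
    exact d.factorial_ne_zero hc
  obtain ⟨w, hw0, hw, hwz⟩ := exists_absVal_pow_eq_of_orbit p hz hfinz
  obtain ⟨j, hj⟩ := hM w hw0 hw
  have hϖL : ϖ ∈ L ⊔ IntermediateField.adjoin K {ϖ} :=
    (le_sup_right : _ ≤ L ⊔ IntermediateField.adjoin K {ϖ})
      (IntermediateField.mem_adjoin_simple_self K ϖ)
  refine ⟨ϖ ^ (-(j * c)), zpow_mem hϖL _, ?_⟩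
  rw [← pow_left_inj₀ zero_le zero_le (mul_ne_zero d.factorial_ne_zero hM0), ← map_pow (absVal p _)
    (ϖ ^ _), ← zpow_natCast (ϖ ^ _), zpow_comm, zpow_natCast, hϖ, map_zpow₀, absVal_prime,
    inv_zpow', neg_neg, hc, mul_assoc, pow_mul, ← hwz, mul_comm, pow_mul, hj, zpow_mul, zpow_natCast]

end Tame

/-! ### The chordal distance on the projective line -/

section Chordal

/-- The point of `ℙ¹(E)` with homogeneous coordinates `a`; junk value `∞` at `(0, 0)`. -/
noncomputable def ofCoords {E : Type*} [Field E] (a : E × E) : OnePoint E :=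
  open Classical in if a.2 = 0 then OnePoint.infty else ((a.1 / a.2 : E) : OnePoint E)

theorem ofCoords_mul {E : Type*} [Field E] {c : E} (hc : c ≠ 0) (a b : E) :
    ofCoords (c * a, c * b) = ofCoords (a, b) := by
  by_cases hb : b = 0
  · simp [ofCoords, hb]
  · simp [ofCoords, hb, hc, mul_div_mul_left]

variable (p : ℕ) [Fact p.Prime] {E : Type*} [Field E] [Algebra ℚ_[p] E]
  [Algebra.IsAlgebraic ℚ_[p] E]

/-- Homogeneous coordinates are primitive when the maximum of their absolute values is `1`. -/
def IsPrimitivePair (a : E × E) : Prop := max (absVal p E a.1) (absVal p E a.2) = 1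

open Classical in
/-- Primitive homogeneous coordinates of a point, equal to `(x, 1)` for integral `x` and to
`(1, x⁻¹)` otherwise. -/
noncomputable def coords : OnePoint E → E × E
  | none => (1, 0)
  | some x => if absVal p E x ≤ 1 then (x, 1) else (1, x⁻¹)

theorem coords_infty : coords p (OnePoint.infty : OnePoint E) = (1, 0) := rfl

theorem coords_coe_of_le {x : E} (hx : absVal p E x ≤ 1) :
    coords p (x : OnePoint E) = (x, 1) := if_pos hx

theorem coords_coe_of_lt {x : E} (hx : 1 < absVal p E x) :
    coords p (x : OnePoint E) = (1, x⁻¹) := if_neg hx.not_ge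

variable {p} in
theorem IsPrimitivePair.le_fst {a : E × E} (h : IsPrimitivePair p a) : absVal p E a.1 ≤ 1 :=
  h ▸ le_max_left _ _

variable {p} in
theorem IsPrimitivePair.le_snd {a : E × E} (h : IsPrimitivePair p a) : absVal p E a.2 ≤ 1 :=
  h ▸ le_max_right _ _

variable {p} in
theorem IsPrimitivePair.eq_one {a : E × E} (h : IsPrimitivePair p a) :
    absVal p E a.1 = 1 ∨ absVal p E a.2 = 1 := by
  rcases le_total (absVal p E a.1) (absVal p E a.2) with h1 | h1
  · exact Or.inr ((max_eq_right h1).symm.trans h)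
  · exact Or.inl ((max_eq_left h1).symm.trans h)

theorem isPrimitivePair_of {a : E × E} (h1 : absVal p E a.1 ≤ 1) (h2 : absVal p E a.2 ≤ 1)
    (h : absVal p E a.1 = 1 ∨ absVal p E a.2 = 1) : IsPrimitivePair p a := by
  refine le_antisymm (max_le h1 h2) ?_
  rcases h with h | h
  · exact h.ge.trans (le_max_left _ _)
  · exact h.ge.trans (le_max_right _ _)

theorem isPrimitivePair_coords (x : OnePoint E) : IsPrimitivePair p (coords p x) := by
  induction x using OnePoint.rec with
  | infty =>
    rw [coords_infty]
    exact isPrimitivePair_of p (by simp) (by simp) (by simp)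
  | coe x =>
    rcases le_or_gt (absVal p E x) 1 with h | h
    · rw [coords_coe_of_le p h]
      exact isPrimitivePair_of p h (by simp) (by simp)
    · rw [coords_coe_of_lt p h]
      refine isPrimitivePair_of p (by simp) ?_ (by simp)
      simp only [map_inv₀]
      exact inv_le_one_of_one_le₀ h.le

theorem ofCoords_coords (x : OnePoint E) : ofCoords (coords p x) = x := by
  induction x using OnePoint.rec with
  | infty => simp [coords_infty, ofCoords]
  | coe x =>
    rcases le_or_gt (absVal p E x) 1 with h | h
    · simp [coords_coe_of_le p h, ofCoords]
    · have h0 : x ≠ 0 := by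
        rintro rfl
        simp at h
      simp [coords_coe_of_lt p h, ofCoords, h0]

theorem ofCoords_eq_iff {a b : E × E} (ha : IsPrimitivePair p a) (hb : IsPrimitivePair p b) :
    ofCoords a = ofCoords b ↔ a.1 * b.2 - a.2 * b.1 = 0 := by
  have hne : ∀ {c : E × E}, IsPrimitivePair p c → c.2 = 0 → c.1 ≠ 0 := by
    intro c hc h2 h1
    have := hc.eq_one
    simp [h1, h2] at this
  obtain ⟨a1, a2⟩ := a
  obtain ⟨b1, b2⟩ := b
  by_cases h1 : a2 = 0 <;> by_cases h2 : b2 = 0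
  · simp [ofCoords, h1, h2]
  · simpa [ofCoords, h1, h2] using hne ha h1
  · simpa [ofCoords, h1, h2] using hne hb h2
  · simp only [ofCoords, h1, h2, if_false, OnePoint.coe_eq_coe, div_eq_div_iff h1 h2]
    rw [sub_eq_zero, mul_comm a2]

/-- Primitive coordinates of a point are unique up to a unit. -/
theorem exists_coords_ofCoords {a : E × E} (ha : IsPrimitivePair p a) :
    ∃ u : E, absVal p E u = 1 ∧ coords p (ofCoords a) = (u * a.1, u * a.2) := by
  have hb := isPrimitivePair_coords p (ofCoords a)
  have h := (ofCoords_eq_iff p hb ha).mp (ofCoords_coords p _)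
  set b := coords p (ofCoords a)
  have hu : ∀ u : E, b = (u * a.1, u * a.2) → absVal p E u = 1 := by
    intro u hbu
    have h1 := hb
    rw [IsPrimitivePair, hbu, map_mul, map_mul, ← mul_max, show max _ _ = _ from ha,
      mul_one] at h1
    exact h1
  rcases ha.eq_one with h1 | h1
  · have h0 : a.1 ≠ 0 := fun h0 => by simp [h0] at h1
    have : b = (b.1 / a.1 * a.1, b.1 / a.1 * a.2) := by
      refine Prod.ext (by field_simp) ?_
      simp only
      field_simp
      linear_combination -h
    exact ⟨_, hu _ this, this⟩
  · have h0 : a.2 ≠ 0 := fun h0 => by simp [h0] at h1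
    have : b = (b.2 / a.2 * a.1, b.2 / a.2 * a.2) := by
      refine Prod.ext ?_ (by field_simp)
      simp only
      field_simp
      linear_combination h
    exact ⟨_, hu _ this, this⟩

/-- The chordal distance on `ℙ¹(E)`. -/
noncomputable def chordal (x y : OnePoint E) : ℝ≥0 :=
  absVal p E ((coords p x).1 * (coords p y).2 - (coords p x).2 * (coords p y).1)

theorem chordal_ofCoords {a b : E × E} (ha : IsPrimitivePair p a) (hb : IsPrimitivePair p b) :
    chordal p (ofCoords a) (ofCoords b) = absVal p E (a.1 * b.2 - a.2 * b.1) := by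
  obtain ⟨u, hu, hua⟩ := exists_coords_ofCoords p ha
  obtain ⟨w, hw, hwb⟩ := exists_coords_ofCoords p hb
  have h : u * a.1 * (w * b.2) - u * a.2 * (w * b.1) = u * w * (a.1 * b.2 - a.2 * b.1) := by ring
  rw [chordal, hua, hwb, h, map_mul, map_mul, hu, hw, one_mul, one_mul]

theorem chordal_self (x : OnePoint E) : chordal p x x = 0 := by
  rw [chordal, mul_comm, sub_self, map_zero]

theorem chordal_comm (x y : OnePoint E) : chordal p x y = chordal p y x := by
  rw [chordal, Valuation.map_sub_swap, chordal]
  congr 1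
  ring

theorem eq_of_chordal_eq_zero {x y : OnePoint E} (h : chordal p x y = 0) : x = y := by
  rw [← ofCoords_coords p x, ← ofCoords_coords p y, ofCoords_eq_iff p
    (isPrimitivePair_coords p x) (isPrimitivePair_coords p y)]
  exact (Valuation.zero_iff _).mp h

theorem chordal_le_max (x y z : OnePoint E) :
    chordal p x z ≤ max (chordal p x y) (chordal p y z) := by
  have hx := isPrimitivePair_coords p x
  have hz := isPrimitivePair_coords p z
  have hy := isPrimitivePair_coords p y
  simp only [chordal]
  set a := coords p x
  set b := coords p y
  set c := coords p z
  rcases hy.eq_one with h | h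
  · have h1 : (a.1 * c.2 - a.2 * c.1) * b.1 =
        (a.1 * b.2 - a.2 * b.1) * c.1 + (b.1 * c.2 - b.2 * c.1) * a.1 := by ring
    have h2 := (absVal p E).map_add ((a.1 * b.2 - a.2 * b.1) * c.1) ((b.1 * c.2 - b.2 * c.1) * a.1)
    rw [← h1, map_mul, h, mul_one, map_mul, map_mul] at h2
    exact h2.trans (max_le_max (mul_le_of_le_one_right zero_le hz.le_fst)
      (mul_le_of_le_one_right zero_le hx.le_fst))
  · have h1 : (a.1 * c.2 - a.2 * c.1) * b.2 =
        (a.1 * b.2 - a.2 * b.1) * c.2 + (b.1 * c.2 - b.2 * c.1) * a.2 := by ring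
    have h2 := (absVal p E).map_add ((a.1 * b.2 - a.2 * b.1) * c.2) ((b.1 * c.2 - b.2 * c.1) * a.2)
    rw [← h1, map_mul, h, mul_one, map_mul, map_mul] at h2
    exact h2.trans (max_le_max (mul_le_of_le_one_right zero_le hz.le_snd)
      (mul_le_of_le_one_right zero_le hx.le_snd))

theorem coords_map {F : Type*} [Field F] [Algebra ℚ_[p] F] [Algebra F E] [IsScalarTower ℚ_[p] F E]
    (σ : E ≃ₐ[F] E) (x : OnePoint E) :
    coords p (x.map σ) = (σ (coords p x).1, σ (coords p x).2) := by
  induction x using OnePoint.rec with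
  | infty => simp [coords_infty]
  | coe x =>
    rw [OnePoint.map_some]
    rcases le_or_gt (absVal p E x) 1 with h | h
    · rw [coords_coe_of_le p h, coords_coe_of_le p (by rwa [absVal_algEquiv]), map_one]
    · rw [coords_coe_of_lt p h, coords_coe_of_lt p (by rwa [absVal_algEquiv]), map_one, map_inv₀]

/-- Inertia acts trivially on the residue discs of the projective line. -/
theorem chordal_map_lt_one {F : Type*} [Field F] [Algebra ℚ_[p] F] [Algebra F E]
    [IsScalarTower ℚ_[p] F E] {σ : E ≃ₐ[F] E}
    (hσ : ∀ x, absVal p E x ≤ 1 → absVal p E (σ x - x) < 1) (x : OnePoint E) :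
    chordal p x (x.map σ) < 1 := by
  have hx := isPrimitivePair_coords p x
  rw [chordal, coords_map]
  set a := coords p x
  have h : a.1 * σ a.2 - a.2 * σ a.1 = a.1 * (σ a.2 - a.2) - a.2 * (σ a.1 - a.1) := by ring
  simp only
  rw [h]
  refine (Valuation.map_sub _ _ _).trans_lt (max_lt ?_ ?_)
  · rw [map_mul]
    exact mul_lt_one_of_nonneg_of_lt_one_right hx.le_fst zero_le (hσ _ hx.le_snd)
  · rw [map_mul]
    exact mul_lt_one_of_nonneg_of_lt_one_right hx.le_snd zero_le (hσ _ hx.le_fst)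

/-- A point close to an integral point is integral. -/
theorem exists_eq_coe_of_chordal_lt {z : integers p E} {y : OnePoint E}
    (h : chordal p ((z : E) : OnePoint E) y < 1) :
    ∃ w : integers p E, y = ((w : E) : OnePoint E) := by
  have h1 : absVal p E ((z : E) * (coords p y).2 - (coords p y).1) < 1 := by
    rw [chordal, coords_coe_of_le p z.2] at h
    simpa using h
  induction y using OnePoint.rec with
  | infty => simp [coords_infty] at h1
  | coe y =>
    rcases le_or_gt (absVal p E y) 1 with hy | hy
    · exact ⟨⟨y, hy⟩, rfl⟩
    · exfalso
      rw [coords_coe_of_lt p hy] at h1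
      simp only at h1
      rw [Valuation.map_sub_swap, Valuation.map_one_sub_of_lt] at h1
      · exact h1.false
      · rw [map_mul, map_inv₀]
        exact mul_lt_one_of_nonneg_of_lt_one_right z.2 zero_le (inv_lt_one_of_one_lt₀ hy)

theorem chordal_coe (z w : integers p E) :
    chordal p ((z : E) : OnePoint E) ((w : E) : OnePoint E) = absVal p E ((z : E) - w) := by
  rw [chordal, coords_coe_of_le p z.2, coords_coe_of_le p w.2]
  simp

/-- A point is either integral, or has coordinates `(1, z)` with `z` in the maximal ideal. -/
theorem exists_eq_coe_or (x : OnePoint E) :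
    (∃ z : integers p E, x = ((z : E) : OnePoint E)) ∨
      ∃ z : integers p E, absVal p E z < 1 ∧ x = ofCoords (1, (z : E)) := by
  induction x using OnePoint.rec with
  | infty => exact Or.inr ⟨0, by simp, by simp [ofCoords]⟩
  | coe x =>
    rcases le_or_gt (absVal p E x) 1 with h | h
    · exact Or.inl ⟨⟨x, h⟩, rfl⟩
    · have h1 : absVal p E x⁻¹ < 1 := by
        rw [map_inv₀]; exact inv_lt_one_of_one_lt₀ h
      refine Or.inr ⟨⟨x⁻¹, h1.le⟩, h1, ?_⟩
      rw [← coords_coe_of_lt p h, ofCoords_coords]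

theorem isPrimitivePair_one_left (z : integers p E) : IsPrimitivePair p (1, (z : E)) :=
  isPrimitivePair_of p (by simp) z.2 (by simp)

theorem chordal_ofCoords_one (z w : integers p E) :
    chordal p (ofCoords (1, (z : E))) (ofCoords (1, (w : E))) = absVal p E ((z : E) - w) := by
  rw [chordal_ofCoords p (isPrimitivePair_one_left p z) (isPrimitivePair_one_left p w),
    Valuation.map_sub_swap]
  simp

end Chordal

/-! ### Residue discs under a map with good reduction -/

section ResidueField

variable (p : ℕ) [Fact p.Prime] {E : Type*} [Field E] [Algebra ℚ_[p] E]
  [Algebra.IsAlgebraic ℚ_[p] E]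

theorem absVal_eq_one_iff (x : integers p E) :
    absVal p E x = 1 ↔ IsLocalRing.residue (integers p E) x ≠ 0 := by
  rw [Ne, residue_eq_zero_iff, not_lt]
  exact ⟨fun h => h.ge, fun h => le_antisymm x.2 h⟩

instance isAlgClosed_residueField [IsAlgClosed E] :
    IsAlgClosed (IsLocalRing.ResidueField (integers p E)) := by
  refine IsAlgClosed.of_exists_root _ fun g hg hirr => ?_
  obtain ⟨G, hG, hdeg, hmon⟩ := lifts_and_natDegree_eq_and_monic
    (f := IsLocalRing.residue (integers p E))
    ((mem_lifts _).mpr (map_surjective _ IsLocalRing.residue_surjective g)) hg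
  have hne : (G.map (algebraMap (integers p E) E)).degree ≠ 0 := by
    rw [hmon.degree_map, degree_eq_natDegree hmon.ne_zero, hdeg]
    exact_mod_cast hirr.natDegree_pos.ne'
  obtain ⟨r, hr⟩ := IsAlgClosed.exists_root _ hne
  have hint : IsIntegral (integers p E) r := ⟨G, hmon, by rwa [IsRoot, eval_map] at hr⟩
  obtain ⟨s, rfl⟩ := IsIntegrallyClosed.isIntegral_iff.mp hint
  refine ⟨IsLocalRing.residue _ s, ?_⟩
  rw [IsRoot, eval_map_algebraMap, aeval_algebraMap_apply] at hr
  have h0 : G.eval s = 0 := by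
    rw [← coe_aeval_eq_eval]
    exact Subtype.ext hr
  rw [← hG, eval_map_apply, h0, map_zero]

/-- A polynomial with nonzero reduction that is small at `z` has a root in the residue disc
of `z`. -/
theorem exists_root_sub_lt_one [IsAlgClosed E] {g : (integers p E)[X]}
    (hg : g.map (IsLocalRing.residue (integers p E)) ≠ 0) {z : integers p E}
    (hz : IsLocalRing.residue (integers p E) (g.eval z) = 0) :
    ∃ r : integers p E, g.eval r = 0 ∧ absVal p E ((r : E) - z) < 1 := by
  set k := IsLocalRing.ResidueField (integers p E)
  obtain ⟨y, hy⟩ : ∃ y : k, (g.map (IsLocalRing.residue (integers p E))).eval y ≠ 0 := by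
    by_contra! h
    exact hg (funext fun y => by rw [h y, eval_zero])
  obtain ⟨u, rfl⟩ := IsLocalRing.residue_surjective y
  rw [eval_map_apply, ← absVal_eq_one_iff] at hy
  rw [residue_eq_zero_iff] at hz
  set G := g.map (algebraMap (integers p E) E)
  have hG : ∀ w : integers p E, G.eval (w : E) = ((g.eval w : integers p E) : E) := fun w =>
    eval_map_apply (algebraMap (integers p E) E) w
  have hsplit : G.Splits := IsAlgClosed.splits G
  obtain ⟨r, hr, hrz⟩ : ∃ r ∈ G.roots, absVal p E ((z : E) - r) < 1 := by
    by_contra! h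
    -- otherwise `|u - r| ≤ |z - r|` for all roots `r`, and `1 = |g(u)| ≤ |g(z)| < 1`
    have hle : absVal p E (G.eval (u : E)) ≤ absVal p E (G.eval (z : E)) := by
      rw [hsplit.eval_eq_prod_roots, hsplit.eval_eq_prod_roots, map_mul, map_mul,
        map_multiset_prod, map_multiset_prod, Multiset.map_map, Multiset.map_map]
      refine mul_le_mul_right (Multiset.prod_map_le_prod_map _ _ fun r hr => ?_) _
      have h1 : (u : E) - r = ((u : E) - z) + (z - r) := by ring
      simp only [Function.comp_apply]
      rw [h1]
      refine ((absVal p E).map_add _ _).trans (max_le ?_ le_rfl)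
      exact ((u - z : integers p E).2 : absVal p E ((u : E) - z) ≤ 1).trans (h r hr)
    rw [hG, hG, hy] at hle
    exact absurd hz (not_lt.mpr hle)
  have hrO : absVal p E r ≤ 1 := by
    have h1 : r = z - (z - r) := by ring
    rw [h1]
    exact (Valuation.map_sub _ _ _).trans (max_le z.2 hrz.le)
  refine ⟨⟨r, hrO⟩, Subtype.ext ?_, by rwa [Valuation.map_sub_swap]⟩
  rw [← hG]
  exact (mem_roots'.mp hr).2

end ResidueField

section LocalChart

variable (p : ℕ) [Fact p.Prime] {E : Type*} [Field E] [Algebra ℚ_[p] E]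
  [Algebra.IsAlgebraic ℚ_[p] E]

/-- `κ` parametrizes the residue disc of `κ z` isometrically, and in this parametrization `F` has
primitive homogeneous coordinates given by the polynomials `A` and `B`, whose reductions are
linearly independent. -/
structure IsLocalChart (F : OnePoint E → OnePoint E) (κ : integers p E → OnePoint E)
    (A B : (integers p E)[X]) (z : integers p E) : Prop where
  exists_eq : ∀ y, chordal p (κ z) y < 1 → ∃ w, y = κ w
  chordal_eq : ∀ u w, chordal p (κ u) (κ w) = absVal p E ((u : E) - w)
  map_eq : ∀ w : integers p E, absVal p E ((w : E) - z) < 1 →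
    F (κ w) = ofCoords (((A.eval w : integers p E) : E), ((B.eval w : integers p E) : E))
  primitive : ∀ w : integers p E, absVal p E ((w : E) - z) < 1 →
    IsPrimitivePair p (((A.eval w : integers p E) : E), ((B.eval w : integers p E) : E))
  independent : ∀ b c : integers p E, absVal p E b = 1 ∨ absVal p E c = 1 →
    (C b * B - C c * A).map (IsLocalRing.residue (integers p E)) ≠ 0

variable {p}
variable {F : OnePoint E → OnePoint E} {κ : integers p E → OnePoint E}
  {A B : (integers p E)[X]} {z : integers p E}

theorem IsLocalChart.exists_eq_and_lt (h : IsLocalChart p F κ A B z) {y : OnePoint E}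
    (hy : chordal p (κ z) y < 1) :
    ∃ w : integers p E, y = κ w ∧ absVal p E ((w : E) - z) < 1 := by
  obtain ⟨w, rfl⟩ := h.exists_eq y hy
  rw [h.chordal_eq, Valuation.map_sub_swap] at hy
  exact ⟨w, rfl, hy⟩

/-- On a residue disc `F` multiplies distances by a factor congruent to the Wronskian. -/
theorem IsLocalChart.exists_factor (h : IsLocalChart p F κ A B z) {x y : OnePoint E}
    (hx : chordal p (κ z) x < 1) (hy : chordal p (κ z) y < 1) :
    ∃ t : integers p E, chordal p (F x) (F y) = absVal p E t * chordal p x y ∧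
      IsLocalRing.residue (integers p E) t = IsLocalRing.residue (integers p E)
        ((derivative A * B - A * derivative B).eval z) := by
  obtain ⟨u, rfl, hu⟩ := h.exists_eq_and_lt hx
  obtain ⟨w, rfl, hw⟩ := h.exists_eq_and_lt hy
  obtain ⟨k, hk⟩ := A.binomExpansion w (u - w)
  obtain ⟨l, hl⟩ := B.binomExpansion w (u - w)
  rw [add_sub_cancel] at hk hl
  refine ⟨(derivative A * B - A * derivative B).eval w +
    (u - w) * (k * B.eval w - l * A.eval w), ?_, ?_⟩
  · rw [h.map_eq u hu, h.map_eq w hw, chordal_ofCoords p (h.primitive u hu) (h.primitive w hw),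
      h.chordal_eq, ← map_mul]
    congr 1
    have : A.eval u * B.eval w - B.eval u * A.eval w =
        ((derivative A * B - A * derivative B).eval w +
          (u - w) * (k * B.eval w - l * A.eval w)) * (u - w) := by
      rw [hk, hl, eval_sub, eval_mul, eval_mul]
      ring
    exact congrArg Subtype.val this
  · have h1 : IsLocalRing.residue (integers p E) w = IsLocalRing.residue (integers p E) z :=
      (residue_eq_residue_iff p _ _).mpr hw
    have h2 : IsLocalRing.residue (integers p E) u = IsLocalRing.residue (integers p E) z :=
      (residue_eq_residue_iff p _ _).mpr hu
    rw [map_add, map_mul, map_sub, h1, h2, sub_self, zero_mul, add_zero, ← eval_map_apply,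
      ← eval_map_apply, h1]

/-- `F` maps the residue disc of `z` onto a residue disc. -/
theorem IsLocalChart.exists_preimage [IsAlgClosed E] (h : IsLocalChart p F κ A B z)
    {x : OnePoint E} (hx : chordal p (F (κ z)) x < 1) :
    ∃ y, chordal p (κ z) y < 1 ∧ F y = x := by
  have hb := isPrimitivePair_coords p x
  obtain ⟨b, hbx⟩ : ∃ b : integers p E, (b : E) = (coords p x).1 := ⟨⟨_, hb.le_fst⟩, rfl⟩
  obtain ⟨c, hcx⟩ : ∃ c : integers p E, (c : E) = (coords p x).2 := ⟨⟨_, hb.le_snd⟩, rfl⟩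
  have hbc : absVal p E b = 1 ∨ absVal p E c = 1 := by
    rw [hbx, hcx]; exact hb.eq_one
  have hz0 : absVal p E ((z : E) - z) < 1 := by simp
  have hval : IsLocalRing.residue (integers p E) ((C b * B - C c * A).eval z) = 0 := by
    rw [residue_eq_zero_iff]
    rw [h.map_eq z hz0, ← ofCoords_coords p x, chordal_ofCoords p (h.primitive z hz0) hb,
      ← hbx, ← hcx, Valuation.map_sub_swap] at hx
    simpa [mul_comm] using hx
  obtain ⟨r, hr, hrz⟩ := exists_root_sub_lt_one p (h.independent b c hbc) hval
  refine ⟨κ r, by rwa [h.chordal_eq, Valuation.map_sub_swap], ?_⟩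
  rw [h.map_eq r hrz, ← ofCoords_coords p x, ofCoords_eq_iff p (h.primitive r hrz) hb, ← hbx,
    ← hcx]
  have h1 := congrArg Subtype.val hr
  simp only [eval_sub, eval_mul, eval_C] at h1
  push_cast at h1
  linear_combination -h1

end LocalChart

/-! ### Good reduction -/

section Independence

theorem C_mul_sub_C_mul_ne_zero {k : Type*} [Field k] {P Q : k[X]} (hcop : IsCoprime P Q)
    (hdeg : max P.natDegree Q.natDegree ≠ 0) {b c : k} (hbc : b ≠ 0 ∨ c ≠ 0) :
    C b * Q - C c * P ≠ 0 := by
  intro h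
  rw [sub_eq_zero] at h
  by_cases hb : b = 0
  · have hc : c ≠ 0 := hbc.resolve_left (not_not.mpr hb)
    have hP : P = 0 := by simpa [hb, hc] using h.symm
    rw [hP, isCoprime_zero_left] at hcop
    simp [hP, natDegree_eq_zero_of_isUnit hcop] at hdeg
  · have hQ : Q = C (c / b) * P := by
      rw [div_eq_inv_mul, C_mul, mul_assoc, ← h, ← mul_assoc, ← C_mul, inv_mul_cancel₀ hb, C_1,
        one_mul]
    have hunit : IsUnit P := hcop.isUnit_of_dvd' dvd_rfl (hQ ▸ Dvd.intro_left _ rfl)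
    have hP := natDegree_eq_zero_of_isUnit hunit
    have hQ' : Q.natDegree = 0 := by
      rw [hQ]
      exact Nat.le_zero.mp ((natDegree_C_mul_le _ _).trans hP.le)
    simp [hP, hQ'] at hdeg

theorem derivative_ne_zero_of_natDegree_lt {k : Type*} [Field k] (p : ℕ) [CharP k p] {P : k[X]}
    (h0 : P.natDegree ≠ 0) (hp : P.natDegree < p) : derivative P ≠ 0 := by
  intro h
  have h1 := congrArg (fun g => g.coeff (P.natDegree - 1)) h
  simp only [coeff_derivative, coeff_zero] at h1
  rw [Nat.sub_add_cancel (Nat.one_le_iff_ne_zero.mpr h0), mul_eq_zero] at h1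
  rcases h1 with h1 | h1
  · exact h0 (by rw [leadingCoeff_eq_zero.mp h1, natDegree_zero])
  · have h2 : ((P.natDegree : ℕ) : k) = 0 := by
      rw [← h1]
      norm_cast
      rw [Nat.sub_add_cancel (Nat.one_le_iff_ne_zero.mpr h0)]
    rw [CharP.cast_eq_zero_iff k p] at h2
    exact absurd (Nat.le_of_dvd (Nat.pos_of_ne_zero h0) h2) (not_le.mpr hp)

/-- A rational map of degree less than the characteristic is separable. -/
theorem wronskian_ne_zero {k : Type*} [Field k] (p : ℕ) [CharP k p] {P Q : k[X]}
    (hcop : IsCoprime P Q) (hdeg : max P.natDegree Q.natDegree ≠ 0)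
    (hp : max P.natDegree Q.natDegree < p) :
    derivative P * Q - P * derivative Q ≠ 0 := by
  intro h
  rw [sub_eq_zero] at h
  have hP : P ∣ derivative P := hcop.dvd_of_dvd_mul_right (h ▸ dvd_mul_right _ _)
  have hQ : Q ∣ derivative Q := hcop.symm.dvd_of_dvd_mul_left (h ▸ dvd_mul_left _ _)
  have key : ∀ g : k[X], g.natDegree < p → g ∣ derivative g → g.natDegree = 0 := by
    intro g hg hdvd
    by_contra h0
    exact derivative_ne_zero_of_natDegree_lt p h0 hg
      (eq_zero_of_dvd_of_natDegree_lt hdvd (natDegree_derivative_lt h0))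
  refine hdeg ?_
  rw [key P ((le_max_left _ _).trans_lt hp) hP, key Q ((le_max_right _ _).trans_lt hp) hQ, max_self]

theorem eval_reflect {k : Type*} [Field k] {g : k[X]} {d : ℕ} (hg : g.natDegree ≤ d) {z : k}
    (hz : z ≠ 0) : (reflect d g).eval z = z ^ d * g.eval z⁻¹ := by
  have : Invertible z⁻¹ := invertibleOfNonzero (inv_ne_zero hz)
  have h := eval₂_reflect_mul_pow (RingHom.id k) z⁻¹ d g hg
  rw [invOf_eq_inv, inv_inv] at h
  simp only [eval₂_id] at h
  rw [← h, mul_comm, mul_assoc, ← mul_pow, inv_mul_cancel₀ hz, one_pow, mul_one]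

end Independence

section Model

variable (p : ℕ) [Fact p.Prime] {K E : Type*} [Field K] [Field E] [Algebra K E]
  [Algebra ℚ_[p] E] [Algebra.IsAlgebraic ℚ_[p] E]

/-- The polynomials `P` and `Q` define the rational function `f` on `ℙ¹(E)`, and their reductions
are coprime and define a map of the same degree `d`. -/
structure IsGoodModel (f : RatFunc K) (d : ℕ) (P Q : (integers p E)[X]) : Prop where
  natDegree_left : P.natDegree ≤ d
  natDegree_right : Q.natDegree ≤ d
  coprime : IsCoprime (P.map (IsLocalRing.residue (integers p E)))
    (Q.map (IsLocalRing.residue (integers p E)))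
  max_natDegree : max (P.map (IsLocalRing.residue (integers p E))).natDegree
    (Q.map (IsLocalRing.residue (integers p E))).natDegree = d
  evalP1_coe : ∀ x : E, evalP1 f (x : OnePoint E) = ofCoords (aeval x P, aeval x Q)
  evalP1_infty : evalP1 f (OnePoint.infty : OnePoint E) =
    ofCoords (((P.coeff d : integers p E) : E), ((Q.coeff d : integers p E) : E))

variable {p} {f : RatFunc K} {d : ℕ} {P Q : (integers p E)[X]}

theorem IsGoodModel.independent (h : IsGoodModel p f d P Q) (hd : d ≠ 0) (b c : integers p E)
    (hbc : absVal p E b = 1 ∨ absVal p E c = 1) :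
    (C b * Q - C c * P).map (IsLocalRing.residue (integers p E)) ≠ 0 := by
  rw [absVal_eq_one_iff, absVal_eq_one_iff] at hbc
  rw [Polynomial.map_sub, Polynomial.map_mul, Polynomial.map_mul, map_C, map_C]
  exact C_mul_sub_C_mul_ne_zero h.coprime (h.max_natDegree.symm ▸ hd) hbc

theorem IsGoodModel.isLocalChart_coe (h : IsGoodModel p f d P Q) (hd : d ≠ 0) (z : integers p E) :
    IsLocalChart p (evalP1 f) (fun w => ((w : E) : OnePoint E)) P Q z where
  exists_eq y hy := exists_eq_coe_of_chordal_lt p hy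
  chordal_eq u w := chordal_coe p u w
  map_eq w _ := by
    rw [h.evalP1_coe]
    exact congrArg ofCoords (Prod.ext (aeval_algebraMap_apply E w P) (aeval_algebraMap_apply E w Q))
  primitive w _ := by
    refine isPrimitivePair_of p (P.eval w).2 (Q.eval w).2 ?_
    simp only [absVal_eq_one_iff]
    by_contra! hlt
    obtain ⟨a, b, hab⟩ := h.coprime
    have := congrArg (eval (IsLocalRing.residue (integers p E) w)) hab
    rw [eval_add, eval_mul, eval_mul, eval_map_apply, eval_map_apply, hlt.1, hlt.2] at this
    simp at this
  independent := h.independent hd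

theorem IsGoodModel.isLocalChart_infty (h : IsGoodModel p f d P Q) (hd : d ≠ 0) {z : integers p E}
    (hz : absVal p E z < 1) :
    IsLocalChart p (evalP1 f) (fun w => ofCoords (1, (w : E))) (reflect d P) (reflect d Q) z where
  exists_eq y hy := by
    rcases exists_eq_coe_or p y with ⟨w, rfl⟩ | ⟨w, -, rfl⟩
    · exfalso
      rw [← ofCoords_coords p ((w : E) : OnePoint E), chordal_ofCoords p
        (isPrimitivePair_one_left p z) (isPrimitivePair_coords p _), coords_coe_of_le p w.2] at hy
      simp only [one_mul] at hy
      rw [Valuation.map_one_sub_of_lt] at hy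
      · exact hy.false
      · rw [map_mul]
        exact mul_lt_one_of_lt_of_le hz w.2
    · exact ⟨w, rfl⟩
  chordal_eq u w := chordal_ofCoords_one p u w
  map_eq w _ := by
    by_cases hw : (w : E) = 0
    · have hw' : w = 0 := Subtype.ext hw
      have : ofCoords ((1 : E), (w : E)) = OnePoint.infty := by simp [ofCoords, hw]
      rw [this, h.evalP1_infty, hw', ← coeff_zero_eq_eval_zero, ← coeff_zero_eq_eval_zero,
        coeff_reflect, coeff_reflect, revAt_zero]
    · have h1 : ofCoords ((1 : E), (w : E)) = (((w : E)⁻¹ : E) : OnePoint E) := by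
        simp [ofCoords, hw]
      have key : ∀ G : (integers p E)[X], G.natDegree ≤ d →
          (((reflect d G).eval w : integers p E) : E) = (w : E) ^ d * aeval ((w : E)⁻¹) G := by
        intro G hG
        rw [← eval_map_algebraMap, ← eval_reflect (natDegree_map_le.trans hG) hw, reflect_map]
        exact (eval_map_apply (algebraMap (integers p E) E) w).symm
      rw [h1, h.evalP1_coe, key P h.natDegree_left, key Q h.natDegree_right,
        ofCoords_mul (pow_ne_zero d hw)]
  primitive w hw := by
    refine isPrimitivePair_of p ((reflect d P).eval w).2 ((reflect d Q).eval w).2 ?_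
    simp only [absVal_eq_one_iff]
    have hw0 : IsLocalRing.residue (integers p E) w = 0 := by
      rw [residue_eq_zero_iff]
      have : (w : E) = (w - z) + z := by ring
      rw [this]
      exact Valuation.map_add_lt _ hw hz
    rw [← eval_map_apply, ← eval_map_apply, hw0, ← coeff_zero_eq_eval_zero,
      ← coeff_zero_eq_eval_zero, ← reflect_map, ← reflect_map, coeff_reflect, coeff_reflect,
      revAt_zero]
    have key : ∀ g : (IsLocalRing.ResidueField (integers p E))[X], g.natDegree = d →
        g.coeff d ≠ 0 := by
      intro g hg h0
      have : g = 0 := leadingCoeff_eq_zero.mp (by rwa [leadingCoeff, hg])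
      rw [this, natDegree_zero] at hg
      exact hd hg.symm
    rcases max_choice (P.map (IsLocalRing.residue (integers p E))).natDegree
      (Q.map (IsLocalRing.residue (integers p E))).natDegree with hm | hm
    · exact Or.inl (key _ (hm.symm.trans h.max_natDegree))
    · exact Or.inr (key _ (hm.symm.trans h.max_natDegree))
  independent b c hbc := by
    rw [← reflect_C_mul, ← reflect_C_mul, ← reflect_sub, ← reflect_map, Ne, reflect_eq_zero_iff]
    exact h.independent hd b c hbc

theorem IsGoodModel.exists_isLocalChart (h : IsGoodModel p f d P Q) (hd : d ≠ 0) (x : OnePoint E) :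
    ∃ κ A B z, κ z = x ∧ IsLocalChart p (evalP1 f) κ A B z := by
  rcases exists_eq_coe_or p x with ⟨z, rfl⟩ | ⟨z, hz, rfl⟩
  · exact ⟨_, _, _, z, rfl, h.isLocalChart_coe hd z⟩
  · exact ⟨_, _, _, z, rfl, h.isLocalChart_infty hd hz⟩

/-- On each residue disc, a map with good reduction is either an isometry or strictly
contracting. -/
theorem IsGoodModel.isometric_or_contracting (h : IsGoodModel p f d P Q) (hd : d ≠ 0)
    (x : OnePoint E) :
    (∀ y z, chordal p x y < 1 → chordal p x z < 1 →
      chordal p (evalP1 f y) (evalP1 f z) = chordal p y z) ∨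
    ∀ y z, chordal p x y < 1 → chordal p x z < 1 → y ≠ z →
      chordal p (evalP1 f y) (evalP1 f z) < chordal p y z := by
  obtain ⟨κ, A, B, z, rfl, hc⟩ := h.exists_isLocalChart hd x
  by_cases hW : IsLocalRing.residue (integers p E)
      ((derivative A * B - A * derivative B).eval z) = 0
  · refine Or.inr fun y w hy hw hne => ?_
    obtain ⟨t, ht, hres⟩ := hc.exists_factor hy hw
    rw [hW, residue_eq_zero_iff] at hres
    rw [ht]
    exact mul_lt_of_lt_one_left
      (pos_iff_ne_zero.mpr fun h0 => hne (eq_of_chordal_eq_zero p h0)) hres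
  · refine Or.inl fun y w hy hw => ?_
    obtain ⟨t, ht, hres⟩ := hc.exists_factor hy hw
    rw [← hres, ← Ne, ← absVal_eq_one_iff] at hW
    rw [ht, hW, one_mul]

/-- All but finitely many residue discs are mapped isometrically. -/
theorem IsGoodModel.exists_finite_contracting (h : IsGoodModel p f d P Q) (hd : d ≠ 0)
    (hdp : d < p) :
    ∃ S : Set (OnePoint E), S.Finite ∧ ∀ x, (∀ c ∈ S, ¬ chordal p c x < 1) →
      ∀ y z, chordal p x y < 1 → chordal p x z < 1 →
        chordal p (evalP1 f y) (evalP1 f z) = chordal p y z := by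
  set k := IsLocalRing.ResidueField (integers p E)
  set W := derivative P * Q - P * derivative Q with hW_def
  have hW : W.map (IsLocalRing.residue (integers p E)) ≠ 0 := by
    rw [hW_def, Polynomial.map_sub, Polynomial.map_mul, Polynomial.map_mul, ← derivative_map,
      ← derivative_map]
    exact wronskian_ne_zero p h.coprime (h.max_natDegree.symm ▸ hd) (h.max_natDegree.symm ▸ hdp)
  let s : k → integers p E := Function.surjInv IsLocalRing.residue_surjective
  have hs : ∀ y, IsLocalRing.residue _ (s y) = y :=
    Function.surjInv_eq IsLocalRing.residue_surjective
  refine ⟨insert OnePoint.infty ((fun y => ((s y : E) : OnePoint E)) ''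
    (W.map (IsLocalRing.residue (integers p E))).rootSet k), ?_, fun x hx y w hy hw => ?_⟩
  · exact ((rootSet_finite _ _).image _).insert _
  rcases exists_eq_coe_or p x with ⟨z, rfl⟩ | ⟨z, hz, rfl⟩
  · obtain ⟨t, ht, hres⟩ := (h.isLocalChart_coe hd z).exists_factor hy hw
    suffices absVal p E t = 1 by rw [ht, this, one_mul]
    rw [absVal_eq_one_iff, hres]
    intro h0
    refine hx _ (Set.mem_insert_of_mem _ ⟨IsLocalRing.residue _ z, ?_, rfl⟩) ?_
    · rw [mem_rootSet]
      refine ⟨hW, ?_⟩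
      rw [coe_aeval_eq_eval, eval_map_apply]
      exact h0
    · rw [chordal_coe, ← residue_eq_residue_iff, hs]
  · refine absurd ?_ (hx _ (Set.mem_insert _ _))
    have h1 : (OnePoint.infty : OnePoint E) = ofCoords (1, ((0 : integers p E) : E)) := by
      simp [ofCoords]
    rw [h1, chordal_ofCoords_one]
    simpa using hz

/-- A map with good reduction induces a map on residue discs. -/
theorem IsGoodModel.chordal_evalP1_le (h : IsGoodModel p f d P Q) (hd : d ≠ 0) {x y : OnePoint E}
    (hxy : chordal p x y < 1) : chordal p (evalP1 f x) (evalP1 f y) ≤ chordal p x y := by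
  have hxx : chordal p x x < 1 := by rw [chordal_self]; exact one_pos
  rcases h.isometric_or_contracting hd x with h1 | h1
  · exact (h1 x y hxx hxy).le
  · rcases eq_or_ne x y with rfl | hne
    · rw [chordal_self, chordal_self]
    · exact (h1 x y hxx hxy hne).le

theorem IsGoodModel.exists_preimage [IsAlgClosed E] (h : IsGoodModel p f d P Q) (hd : d ≠ 0)
    {x y : OnePoint E} (hxy : chordal p (evalP1 f x) y < 1) :
    ∃ z, chordal p x z < 1 ∧ evalP1 f z = y := by
  obtain ⟨κ, A, B, z, rfl, hc⟩ := h.exists_isLocalChart hd x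
  exact hc.exists_preimage hxy

end Model

section Fiber

theorem wedge_eq_zero_of_ofCoords_eq {E : Type*} [Field E] {a b : E × E}
    (h : ofCoords a = ofCoords b) : a.1 * b.2 - a.2 * b.1 = 0 := by
  obtain ⟨a1, a2⟩ := a
  obtain ⟨b1, b2⟩ := b
  by_cases h1 : a2 = 0 <;> by_cases h2 : b2 = 0
  · simp [h1, h2]
  · simp [ofCoords, h1, h2] at h
  · simp [ofCoords, h1, h2] at h
  · simp only [ofCoords, h1, h2, if_false, OnePoint.coe_eq_coe, div_eq_div_iff h1 h2] at h
    linear_combination h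

variable {p : ℕ} [Fact p.Prime] {K E : Type*} [Field K] [Field E] [Algebra K E]
  [Algebra ℚ_[p] E] [Algebra.IsAlgebraic ℚ_[p] E]
  {f : RatFunc K} {d : ℕ} {P Q : (integers p E)[X]}

/-- The affine part of a fiber has at most `d` elements. -/
theorem IsGoodModel.ncard_fiber_le (h : IsGoodModel p f d P Q) (hd : d ≠ 0) (y : OnePoint E) :
    {x : E | evalP1 f (x : OnePoint E) = y}.Finite ∧
      {x : E | evalP1 f (x : OnePoint E) = y}.ncard ≤ d := by
  have hb := isPrimitivePair_coords p y
  obtain ⟨b, hbx⟩ : ∃ b : integers p E, (b : E) = (coords p y).1 := ⟨⟨_, hb.le_fst⟩, rfl⟩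
  obtain ⟨c, hcx⟩ : ∃ c : integers p E, (c : E) = (coords p y).2 := ⟨⟨_, hb.le_snd⟩, rfl⟩
  have hbc : absVal p E b = 1 ∨ absVal p E c = 1 := by
    rw [hbx, hcx]; exact hb.eq_one
  set g := C b * Q - C c * P with hg
  have hg0 : g ≠ 0 := fun h0 => h.independent hd b c hbc (by rw [← hg, h0, Polynomial.map_zero])
  have hdeg : g.natDegree ≤ d := (natDegree_sub_le _ _).trans (max_le
    ((natDegree_C_mul_le _ _).trans h.natDegree_right)
    ((natDegree_C_mul_le _ _).trans h.natDegree_left))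
  have hsub : {x : E | evalP1 f (x : OnePoint E) = y} ⊆ g.rootSet E := by
    intro x hx
    rw [Set.mem_ofPred_eq, h.evalP1_coe, ← ofCoords_coords p y] at hx
    have hw := wedge_eq_zero_of_ofCoords_eq hx
    rw [← hbx, ← hcx] at hw
    rw [mem_rootSet]
    refine ⟨hg0, ?_⟩
    have h1 : aeval x g = b * aeval x Q - c * aeval x P := by
      rw [hg, map_sub, map_mul, map_mul, aeval_C, aeval_C]
      rfl
    rw [h1]
    linear_combination -hw
  refine ⟨(rootSet_finite g E).subset hsub, (Set.ncard_le_ncard hsub (rootSet_finite g E)).trans ?_⟩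
  exact (ncard_rootSet_le g E).trans hdeg

end Fiber

section Existence

variable (p : ℕ) [Fact p.Prime] {K : Type*} [Field K] [Algebra ℚ_[p] K]
  [Algebra.IsAlgebraic ℚ_[p] K] (E : Type*) [Field E] [Algebra ℚ_[p] E]
  [Algebra.IsAlgebraic ℚ_[p] E] [Algebra K E] [IsScalarTower ℚ_[p] K E]

theorem absVal_algebraMap_tower (x : K) : absVal p E (algebraMap K E x) = absVal p K x :=
  NNReal.eq (spectralNorm.eq_of_tower (E := K) (L := E) x).symm

variable (K) in
/-- The inclusion of valuation rings. -/
noncomputable def integersMap : integers p K →+* integers p E :=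
  ((algebraMap K E).comp (integers p K).subtype).codRestrict (integers p E) fun x =>
    (mem_integers_iff p).mpr ((absVal_algebraMap_tower p E (x : K)).trans_le x.2)

theorem coe_integersMap (x : integers p K) : (integersMap p K E x : E) = algebraMap K E x := rfl

instance isLocalHom_integersMap : IsLocalHom (integersMap p K E) where
  map_nonunit x hx := by
    by_contra h
    rw [← mem_nonunits_iff, ← IsLocalRing.mem_maximalIdeal, ← IsLocalRing.residue_eq_zero_iff,
      residue_eq_zero_iff, ← absVal_algebraMap_tower p E, ← coe_integersMap, ← residue_eq_zero_iff,
      IsLocalRing.residue_eq_zero_iff, IsLocalRing.mem_maximalIdeal] at h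
    exact h hx

/-- Polynomials `P, Q` of degree at most `deg f` with `f = P / Q` are proportional to the
numerator and the denominator of `f`. -/
theorem exists_eq_C_mul_num_denom {f : RatFunc K} {P Q : K[X]} (hP : P.natDegree ≤ ratDegree f)
    (hQ : Q.natDegree ≤ ratDegree f) (hQ0 : Q ≠ 0) (hd : ratDegree f ≠ 0)
    (hf : f = algebraMap K[X] (RatFunc K) P / algebraMap K[X] (RatFunc K) Q) :
    ∃ c : K, c ≠ 0 ∧ P = C c * f.num ∧ Q = C c * f.denom := by
  have hQ' : algebraMap K[X] (RatFunc K) Q ≠ 0 := RatFunc.algebraMap_ne_zero hQ0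
  have hden : algebraMap K[X] (RatFunc K) f.denom ≠ 0 := RatFunc.algebraMap_ne_zero f.denom_ne_zero
  have hcross : P * f.denom = f.num * Q := by
    have h := hf
    conv_lhs at h => rw [← RatFunc.num_div_denom f]
    rw [div_eq_div_iff hden hQ', ← map_mul, ← map_mul] at h
    exact (RatFunc.algebraMap_injective K h).symm
  obtain ⟨g, rfl⟩ : f.denom ∣ Q :=
    f.isCoprime_num_denom.symm.dvd_of_dvd_mul_left (Dvd.intro_left P hcross)
  have hPg : P = f.num * g := mul_right_cancel₀ f.denom_ne_zero (by rw [hcross]; ring)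
  have hg0 : g ≠ 0 := right_ne_zero_of_mul hQ0
  have hg : g.natDegree = 0 := by
    rw [natDegree_mul f.denom_ne_zero hg0] at hQ
    rcases max_choice f.num.natDegree f.denom.natDegree with h | h
    · have hnum : f.num ≠ 0 := fun h0 => hd (by rw [ratDegree, h, h0, natDegree_zero])
      rw [hPg, natDegree_mul hnum hg0] at hP
      rw [ratDegree] at hP
      omega
    · rw [ratDegree] at hQ
      omega
  rw [natDegree_eq_zero] at hg
  obtain ⟨c, rfl⟩ := hg
  exact ⟨c, fun h0 => hg0 (by rw [h0, C_0]), by rw [hPg, mul_comm], mul_comm _ _⟩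

theorem HasGoodReduction.exists_isGoodModel {f : RatFunc K} (hf : HasGoodReduction p f)
    (hd : ratDegree f ≠ 0) : ∃ P Q : (integers p E)[X], IsGoodModel p f (ratDegree f) P Q := by
  obtain ⟨P, Q, hP, hQ, hQ0, hfPQ, hcop, hmax⟩ := hf
  have hinj : Function.Injective (algebraMap (integers p K) K) := Subtype.val_injective
  obtain ⟨c, hc0, hPc, hQc⟩ := exists_eq_C_mul_num_denom (f := f)
    (natDegree_map_le.trans hP) (natDegree_map_le.trans hQ)
    ((Polynomial.map_ne_zero_iff hinj).mpr hQ0) hd hfPQ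
  have hc0' : algebraMap K E c ≠ 0 := (map_ne_zero_iff _ (algebraMap K E).injective).mpr hc0
  have hres : ∀ G : (integers p K)[X], (G.map (integersMap p K E)).map
      (IsLocalRing.residue (integers p E)) = (G.map (IsLocalRing.residue (integers p K))).map
        (IsLocalRing.ResidueField.map (integersMap p K E)) := fun G => by
    rw [Polynomial.map_map, Polynomial.map_map, IsLocalRing.ResidueField.map_comp_residue]
  have haeval : ∀ (G : (integers p K)[X]) (x : E), aeval x (G.map (integersMap p K E)) =
      aeval x (G.map (algebraMap (integers p K) K)) := fun G x => by
    rw [aeval_def, aeval_def, eval₂_map, eval₂_map]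
    rfl
  have hcoeff : ∀ (G : (integers p K)[X]) (n : ℕ), (((G.map (integersMap p K E)).coeff n :
      integers p E) : E) = algebraMap K E ((G.map (algebraMap (integers p K) K)).coeff n) :=
    fun G n => by
      rw [coeff_map, coeff_map]
      rfl
  refine ⟨P.map (integersMap p K E), Q.map (integersMap p K E), natDegree_map_le.trans hP,
    natDegree_map_le.trans hQ, ?_, ?_, fun x => ?_, ?_⟩
  · rw [hres, hres]
    have := hcop.map (mapRingHom (IsLocalRing.ResidueField.map (integersMap p K E)))
    rwa [coe_mapRingHom] at this
  · rw [hres, hres, natDegree_map (IsLocalRing.ResidueField.map (integersMap p K E)),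
      natDegree_map (IsLocalRing.ResidueField.map (integersMap p K E)), hmax]
  · rw [haeval, haeval, hPc, hQc, map_mul, map_mul, aeval_C, ofCoords_mul hc0']
    rfl
  · rw [hcoeff, hcoeff, hPc, hQc, coeff_C_mul, coeff_C_mul, map_mul, map_mul, ofCoords_mul hc0']
    change evalP1 f none = _
    by_cases hlt : f.denom.natDegree < f.num.natDegree
    · have h1 : ratDegree f = f.num.natDegree := max_eq_left hlt.le
      simp only [evalP1, if_pos hlt, ofCoords]
      rw [h1, coeff_eq_zero_of_natDegree_lt hlt, map_zero, if_pos rfl]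
    · have h1 : ratDegree f = f.denom.natDegree := max_eq_right (not_lt.mp hlt)
      have h2 : algebraMap K E f.denom.leadingCoeff ≠ 0 :=
        (map_ne_zero_iff _ (algebraMap K E).injective).mpr
          (leadingCoeff_ne_zero.mpr f.denom_ne_zero)
      simp only [evalP1, if_neg hlt, ofCoords]
      rw [h1, coeff_natDegree, if_neg h2, map_div₀]

end Existence

/-! ### Dynamics on residue discs -/

section Discs

variable (p : ℕ) [Fact p.Prime] {K E : Type*} [Field K] [Field E] [Algebra K E]
  [Algebra ℚ_[p] E] [Algebra.IsAlgebraic ℚ_[p] E]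

theorem chordal_lt_one_trans {x y z : OnePoint E} (h1 : chordal p x y < 1)
    (h2 : chordal p y z < 1) : chordal p x z < 1 :=
  (chordal_le_max p x y z).trans_lt (max_lt h1 h2)

theorem chordal_lt_one_symm {x y : OnePoint E} (h : chordal p x y < 1) : chordal p y x < 1 :=
  (chordal_comm p y x).trans_lt h

/-- `f` is an isometry on the residue disc of `x`, i.e. its reduction is unramified there. -/
def IsIsometricAt (f : RatFunc K) (x : OnePoint E) : Prop :=
  ∀ y z, chordal p x y < 1 → chordal p x z < 1 →
    chordal p (evalP1 f y) (evalP1 f z) = chordal p y z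

/-- The residue disc of `x` is periodic under `f`. -/
def IsPeriodicDisc (f : RatFunc K) (x : OnePoint E) : Prop :=
  ∃ m, m ≠ 0 ∧ chordal p x ((evalP1 f)^[m] x) < 1

variable {p} {f : RatFunc K} {d : ℕ} {P Q : (integers p E)[X]}

theorem IsGoodModel.chordal_iterate_le (h : IsGoodModel p f d P Q) (hd : d ≠ 0) (n : ℕ)
    {x y : OnePoint E} (hxy : chordal p x y < 1) :
    chordal p ((evalP1 f)^[n] x) ((evalP1 f)^[n] y) ≤ chordal p x y := by
  induction n with
  | zero => exact le_rfl
  | succ n ih =>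
    rw [Function.iterate_succ_apply', Function.iterate_succ_apply']
    exact (h.chordal_evalP1_le hd (ih.trans_lt hxy)).trans ih

theorem IsGoodModel.exists_preimage_iterate [IsAlgClosed E] (h : IsGoodModel p f d P Q)
    (hd : d ≠ 0) (n : ℕ) {x y : OnePoint E} (hxy : chordal p ((evalP1 f)^[n] x) y < 1) :
    ∃ z, chordal p x z < 1 ∧ (evalP1 f)^[n] z = y := by
  induction n generalizing x with
  | zero => exact ⟨y, hxy, rfl⟩
  | succ n ih =>
    obtain ⟨w, hw, rfl⟩ := ih (x := evalP1 f x) hxy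
    obtain ⟨z, hz, rfl⟩ := h.exists_preimage hd hw
    exact ⟨z, hz, rfl⟩

theorem IsGoodModel.chordal_iterate_mul_lt (h : IsGoodModel p f d P Q) (hd : d ≠ 0) {m : ℕ}
    {x : OnePoint E} (hm : chordal p x ((evalP1 f)^[m] x) < 1) (k : ℕ) :
    chordal p x ((evalP1 f)^[m * k] x) < 1 := by
  induction k with
  | zero => simp [chordal_self]
  | succ k ih =>
    rw [Nat.mul_succ, add_comm, Function.iterate_add_apply]
    exact chordal_lt_one_trans p hm ((h.chordal_iterate_le hd m ih).trans_lt ih)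

/-- An iterate of `f` is strictly contracting on a residue disc whose orbit meets a disc on which
`f` is not isometric. -/
theorem IsGoodModel.chordal_iterate_lt (h : IsGoodModel p f d P Q) (hd : d ≠ 0) {x : OnePoint E}
    {i n : ℕ} (hi : i < n) (hnot : ¬ IsIsometricAt p f ((evalP1 f)^[i] x)) {y z : OnePoint E}
    (hy : chordal p x y < 1) (hz : chordal p x z < 1) (hne : y ≠ z) :
    chordal p ((evalP1 f)^[n] y) ((evalP1 f)^[n] z) < chordal p y z := by
  have hyz : chordal p y z < 1 := chordal_lt_one_trans p (chordal_lt_one_symm p hy) hz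
  have hstrict := (h.isometric_or_contracting hd ((evalP1 f)^[i] x)).resolve_left hnot
  have h1 : chordal p (evalP1 f ((evalP1 f)^[i] y)) (evalP1 f ((evalP1 f)^[i] z)) <
      chordal p y z := by
    by_cases heq : (evalP1 f)^[i] y = (evalP1 f)^[i] z
    · rw [heq, chordal_self]
      exact pos_iff_ne_zero.mpr fun h0 => hne (eq_of_chordal_eq_zero p h0)
    · exact (hstrict _ _ ((h.chordal_iterate_le hd i hy).trans_lt hy)
        ((h.chordal_iterate_le hd i hz).trans_lt hz) heq).trans_le (h.chordal_iterate_le hd i hyz)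
  rw [← Function.iterate_succ_apply' (evalP1 f), ← Function.iterate_succ_apply' (evalP1 f)] at h1
  obtain ⟨j, rfl⟩ : ∃ j, n = j + (i + 1) := ⟨n - (i + 1), by omega⟩
  rw [Function.iterate_add_apply _ j, Function.iterate_add_apply _ j]
  exact (h.chordal_iterate_le hd j (h1.trans hyz)).trans_lt h1

variable (p) in
open Classical in
/-- The number of times the orbit segment `x, f x, …, fⁿ⁻¹ x` meets a ramified residue disc which
is not periodic. -/
noncomputable def ramifiedCount (f : RatFunc K) (n : ℕ) (x : OnePoint E) : ℕ :=
  ∑ i ∈ Finset.range n, if ¬ IsIsometricAt p f ((evalP1 f)^[i] x) ∧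
    ¬ IsPeriodicDisc p f ((evalP1 f)^[i] x) then 1 else 0

open Classical in
theorem ramifiedCount_succ (n : ℕ) (x : OnePoint E) :
    ramifiedCount p f (n + 1) x = ramifiedCount p f n (evalP1 f x) +
      if ¬ IsIsometricAt p f x ∧ ¬ IsPeriodicDisc p f x then 1 else 0 := by
  rw [ramifiedCount, Finset.sum_range_succ']
  rfl

/-- A ramified disc which is not periodic is met at most once by an orbit. -/
theorem ramifiedCount_le {S : Set (OnePoint E)} (hS : S.Finite)
    (hiso : ∀ x, (∀ c ∈ S, ¬ chordal p c x < 1) → IsIsometricAt p f x) (n : ℕ) (x : OnePoint E) :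
    ramifiedCount p f n x ≤ S.ncard := by
  classical
  rw [ramifiedCount, Finset.sum_boole, Set.ncard_eq_toFinset_card S hS, Nat.cast_id]
  have hex : ∀ i, ∃ c, ¬ IsIsometricAt p f ((evalP1 f)^[i] x) →
      c ∈ S ∧ chordal p c ((evalP1 f)^[i] x) < 1 := fun i => by
    by_cases hi : IsIsometricAt p f ((evalP1 f)^[i] x)
    · exact ⟨x, fun h => absurd hi h⟩
    · have := mt (hiso _) hi
      push Not at this
      obtain ⟨c, hc, hlt⟩ := this
      exact ⟨c, fun _ => ⟨hc, hlt⟩⟩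
  choose c hc using hex
  refine Finset.card_le_card_of_injOn c (fun i hi => ?_) fun i hi j hj hij => ?_
  · exact hS.mem_toFinset.mpr (hc i (Finset.mem_filter.mp hi).2.1).1
  · have hi' := (Finset.mem_filter.mp hi).2
    have hj' := (Finset.mem_filter.mp hj).2
    clear hi hj
    by_contra hne
    wlog hlt : i < j generalizing i j
    · exact this j i hij.symm hj' hi' (Ne.symm hne) (by omega)
    refine hi'.2 ⟨j - i, by omega, ?_⟩
    rw [← Function.iterate_add_apply, Nat.sub_add_cancel hlt.le]
    have h1 := (hc j hj'.1).2
    rw [← hij] at h1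
    exact chordal_lt_one_trans p (chordal_lt_one_symm p (hc i hi'.1).2) h1

end Discs

section Ramification

variable {p : ℕ} [Fact p.Prime] {K : Type*} [Field K] [Algebra ℚ_[p] K]
  [FiniteDimensional ℚ_[p] K] {f : RatFunc K} {d : ℕ} {P Q : (integers p (AlgebraicClosure K))[X]}

/-- There is no ramification above a fixed point where the reduction is unramified. -/
theorem map_eq_of_isIsometricAt {L : IntermediateField K (AlgebraicClosure K)}
    {σ : AlgebraicClosure K ≃ₐ[K] AlgebraicClosure K} (hσ : σ ∈ inertia p L)
    {x : OnePoint (AlgebraicClosure K)} (hx : IsIsometricAt p f x)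
    (hfx : (evalP1 f x).map σ = evalP1 f x) : x.map σ = x := by
  have h := hx x (x.map σ) (by rw [chordal_self]; exact one_pos) (chordal_map_lt_one p hσ.2 x)
  rw [evalP1_map, hfx, chordal_self] at h
  exact (eq_of_chordal_eq_zero p h.symm).symm

theorem IsGoodModel.exists_inertia_fixes_preimages (h : IsGoodModel p f d P Q) (hd : d ≠ 0)
    (hdp : d < p) (L : IntermediateField K (AlgebraicClosure K)) [FiniteDimensional K L] :
    ∃ L' : IntermediateField K (AlgebraicClosure K), L ≤ L' ∧ FiniteDimensional K L' ∧
      ∀ x : OnePoint (AlgebraicClosure K),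
        (∀ σ ∈ inertia p L, (evalP1 f x).map σ = evalP1 f x) →
          ∀ σ ∈ inertia p L', x.map σ = x := by
  obtain ⟨L', hle, hfin, hL'⟩ := exists_inertia_fixes_of_orbit_le p hdp L
  refine ⟨L', hle, hfin, fun x hx σ hσ => ?_⟩
  induction x using OnePoint.rec with
  | infty => rfl
  | coe x =>
    obtain ⟨h1, h2⟩ := h.ncard_fiber_le hd (evalP1 f (x : OnePoint (AlgebraicClosure K)))
    rw [OnePoint.map_some, hL' x _ h1 h2 (fun τ hτ => ?_) σ hσ]
    rw [Set.mem_ofPred_eq, ← OnePoint.map_some, evalP1_map, hx τ hτ]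

/-- If inertia fixes all vertices in periodic discs, then the inertia group of a suitable finite
extension fixes all vertices with at most `k` ramified steps in nonperiodic discs. -/
theorem IsGoodModel.exists_inertia_fixes (h : IsGoodModel p f d P Q) (hd : d ≠ 0)
    (hdp : d < p) {b : OnePoint (AlgebraicClosure K)}
    (hb : ∀ σ : AlgebraicClosure K ≃ₐ[K] AlgebraicClosure K, b.map σ = b)
    (hper : ∀ n x, (evalP1 f)^[n] x = b → IsPeriodicDisc p f x →
      ∀ σ ∈ inertia p (⊥ : IntermediateField K (AlgebraicClosure K)), x.map σ = x) (k : ℕ) :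
    ∃ L : IntermediateField K (AlgebraicClosure K), FiniteDimensional K L ∧
      ∀ n x, (evalP1 f)^[n] x = b → ramifiedCount p f n x ≤ k →
        ∀ σ ∈ inertia p L, x.map σ = x := by
  classical
  induction k with
  | zero =>
    refine ⟨⊥, inferInstance, fun n => ?_⟩
    induction n with
    | zero =>
      rintro x rfl - σ -
      exact hb σ
    | succ n ih =>
      intro x hx hcount σ hσ
      by_cases hp : IsPeriodicDisc p f x
      · exact hper _ x hx hp σ hσ
      rw [ramifiedCount_succ] at hcount
      by_cases hi : IsIsometricAt p f x
      · exact map_eq_of_isIsometricAt hσ hi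
          (ih _ hx ((Nat.le_add_right _ _).trans hcount) σ hσ)
      · rw [if_pos ⟨hi, hp⟩] at hcount
        omega
  | succ k ihk =>
    obtain ⟨L, hfin, hL⟩ := ihk
    obtain ⟨L', hle, hfin', hL'⟩ := h.exists_inertia_fixes_preimages hd hdp L
    refine ⟨L', hfin', fun n => ?_⟩
    induction n with
    | zero =>
      rintro x rfl - σ -
      exact hb σ
    | succ n ih =>
      intro x hx hcount σ hσ
      by_cases hp : IsPeriodicDisc p f x
      · exact hper _ x hx hp σ (inertia_anti p bot_le hσ)
      rw [ramifiedCount_succ] at hcount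
      by_cases hi : IsIsometricAt p f x
      · exact map_eq_of_isIsometricAt hσ hi
          (ih _ hx ((Nat.le_add_right _ _).trans hcount) σ hσ)
      · rw [if_pos ⟨hi, hp⟩] at hcount
        exact hL' x (fun τ hτ => hL n _ hx (by omega) τ hτ) σ hσ

/-- Distances between points fixed by the inertia group of a finite extension of `K` form a
discrete set. -/
theorem exists_chordal_pow_eq_zpow (L : IntermediateField K (AlgebraicClosure K))
    [FiniteDimensional K L] : ∃ M : ℕ, M ≠ 0 ∧ ∀ x y : OnePoint (AlgebraicClosure K), x ≠ y →
      (∀ σ ∈ inertia p L, x.map σ = x) → (∀ σ ∈ inertia p L, y.map σ = y) →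
        ∃ j : ℤ, chordal p x y ^ M = (p : ℝ≥0) ^ j := by
  obtain ⟨M, hM0, hM⟩ := exists_absVal_pow_eq_zpow p L
  refine ⟨M, hM0, fun x y hxy hx hy => hM _ (fun h0 => hxy ?_) fun σ hσ => ?_⟩
  · exact eq_of_chordal_eq_zero p (by rw [chordal, h0, map_zero])
  · have h1 := coords_map p σ x
    have h2 := coords_map p σ y
    rw [hx σ hσ] at h1
    rw [hy σ hσ] at h2
    obtain ⟨h1, h1'⟩ := Prod.ext_iff.mp h1
    obtain ⟨h2, h2'⟩ := Prod.ext_iff.mp h2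
    simp only at h1 h1' h2 h2'
    rw [map_sub, map_mul, map_mul, ← h1, ← h1', ← h2, ← h2']

/-- A vertex in a periodic disc which is moved by inertia lies on an infinitely ramified branch. -/
theorem IsGoodModel.exists_branch (h : IsGoodModel p f d P Q) (hd : d ≠ 0) {a : OnePoint K}
    (ha : ∀ σ : AlgebraicClosure K ≃ₐ[K] AlgebraicClosure K,
      (a.map (algebraMap K (AlgebraicClosure K))).map σ = a.map (algebraMap K (AlgebraicClosure K)))
    {n : ℕ} {x : OnePoint (AlgebraicClosure K)}
    (hx : (evalP1 f)^[n] x = a.map (algebraMap K (AlgebraicClosure K)))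
    (hper : IsPeriodicDisc p f x)
    {σ : AlgebraicClosure K ≃ₐ[K] AlgebraicClosure K}
    (hσ : σ ∈ inertia p (⊥ : IntermediateField K (AlgebraicClosure K))) (hσx : x.map σ ≠ x) :
    ∃ B : Branch f a, IsInfinitelyRamified p B.rep := by
  obtain ⟨i, hin, hi⟩ : ∃ i < n, ¬ IsIsometricAt p f ((evalP1 f)^[i] x) := by
    by_contra! hall
    refine hσx ?_
    clear hσx hper
    induction n generalizing x with
    | zero => rw [show x = _ from hx, ha]
    | succ n ih =>
      exact map_eq_of_isIsometricAt hσ (hall 0 n.succ_pos)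
        (ih hx fun i hi => hall (i + 1) (Nat.succ_lt_succ hi))
  -- an iterate `f^M` maps the disc of `x` onto itself and is strictly contracting there
  obtain ⟨m, hm0, hm⟩ := hper
  set M := m * (n + 1) with hM_def
  have hnM : n < M := by
    have := Nat.le_mul_of_pos_left (n + 1) (Nat.pos_of_ne_zero hm0)
    omega
  have hM : chordal p ((evalP1 f)^[M] x) x < 1 :=
    chordal_lt_one_symm p (h.chordal_iterate_mul_lt hd hm (n + 1))
  have hpre : ∀ y : {y // chordal p x y < 1}, ∃ z : {z // chordal p x z < 1},
      (evalP1 f)^[M] (z : OnePoint (AlgebraicClosure K)) = y := fun y => by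
    obtain ⟨z, hz, hzy⟩ := h.exists_preimage_iterate hd M (chordal_lt_one_trans p hM y.2)
    exact ⟨⟨z, hz⟩, hzy⟩
  choose g hg using hpre
  let γ : ℕ → OnePoint (AlgebraicClosure K) := fun k =>
    (g^[k] ⟨x, by rw [chordal_self]; exact one_pos⟩).1
  have hγx : ∀ k, chordal p x (γ k) < 1 := fun k => (g^[k] _).2
  have hγ : ∀ k, (evalP1 f)^[M] (γ (k + 1)) = γ k := fun k => by
    simp only [γ]
    rw [Function.iterate_succ_apply', hg]
  have hγ' : ∀ j k, (evalP1 f)^[M * j] (γ (k + j)) = γ k := fun j => by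
    induction j with
    | zero => exact fun k => rfl
    | succ j ih =>
      intro k
      rw [Nat.mul_succ, Function.iterate_add_apply, ← add_assoc, hγ, ih]
  -- `γ k` is placed at level `n + M k`; level `i` is reached from `γ i`, which lies above it
  let B : Branch f a :=
    { pt := fun i => (evalP1 f)^[n + M * i - i] (γ i)
      pt_zero := hx
      evalP1_pt_succ := fun i => by
        have h1 : i ≤ M * i := Nat.le_mul_of_pos_left i (by omega)
        have h2 : n + M * (i + 1) - (i + 1) + 1 = (n + M * i - i) + M := by
          rw [Nat.mul_succ]; omega
        rw [← Function.iterate_succ_apply' (evalP1 f), Nat.succ_eq_add_one, h2,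
          Function.iterate_add_apply, hγ] }
  have hBγ : ∀ k, B.pt (n + M * k) = γ k := fun k => by
    change (evalP1 f)^[_] _ = _
    obtain ⟨j, hj⟩ : ∃ j, n + M * k = k + j :=
      ⟨n + M * k - k, by have := Nat.le_mul_of_pos_left k (show 0 < M by omega); omega⟩
    have h1 : n + M * (n + M * k) - (n + M * k) = M * j := by
      rw [hj, Nat.mul_add]; omega
    rw [h1, hj, hγ']
  refine ⟨B, (isInfinitelyRamified_iff p _).mpr fun L hL hker => ?_⟩
  have hfix : ∀ (τ : AlgebraicClosure K ≃ₐ[K] AlgebraicClosure K) (k : ℕ), ∀ σ' ∈ inertia p L,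
      ((γ k).map τ).map σ' =
        (γ k).map τ := fun τ k σ' hσ' => by
    have := mem_ker_treeRep.mp (hker hσ') (n + M * k, (B.pt (n + M * k)).map τ) ⟨τ, rfl⟩
    rwa [hBγ] at this
  have hmap_one : ∀ y : OnePoint (AlgebraicClosure K),
      y.map (1 : AlgebraicClosure K ≃ₐ[K] AlgebraicClosure K) = y := fun y => by
    induction y using OnePoint.rec <;> simp
  have hcomm : ∀ k, (evalP1 f)^[k] ∘ OnePoint.map σ = OnePoint.map σ ∘ (evalP1 f)^[k] := fun k =>
    funext fun y => (Function.Commute.iterate_left (fun y => evalP1_map f σ y) k).eq y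
  -- the distances between the branch and its conjugate under `σ` increase strictly
  let δ : ℕ → ℝ≥0 := fun k =>
    chordal p (γ k) ((γ k).map σ)
  have hne : ∀ k, (γ k) ≠
      (γ k).map σ := fun k heq => by
    refine hσx ?_
    have h1 := hγ' k 0
    rw [zero_add] at h1
    have h2 : x = (evalP1 f)^[M * k] (γ k) := h1.symm
    rw [h2]
    conv_rhs => rw [heq]
    exact (congrFun (hcomm (M * k)) _).symm
  have hδ1 : ∀ k, δ k < 1 := fun k => chordal_map_lt_one p hσ.2 _
  have hδ : StrictMono δ := strictMono_nat_of_lt_succ fun k => by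
    have h1 := h.chordal_iterate_lt hd (hin.trans hnM) hi (hγx (k + 1))
      (chordal_lt_one_trans p (hγx (k + 1)) (hδ1 (k + 1))) (hne (k + 1))
    rwa [hγ, show (evalP1 f)^[M] ((γ (k + 1)).map σ) = _ from
      congrFun (hcomm M) _, Function.comp_apply, hγ] at h1
  obtain ⟨N, hN0, hN⟩ := exists_chordal_pow_eq_zpow (p := p) L
  have hj : ∀ k, ∃ j : ℤ, δ k ^ N = (p : ℝ≥0) ^ j := fun k =>
    hN _ _ (hne k) (fun σ' hσ' => by simpa only [hmap_one] using hfix 1 k σ' hσ') (hfix σ k)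
  choose j hj using hj
  have hp1 : (1 : ℝ≥0) < p := by exact_mod_cast (Fact.out : p.Prime).one_lt
  have hjmono : StrictMono j := fun k l hkl => by
    have h1 := pow_lt_pow_left₀ (hδ hkl) zero_le hN0
    rw [hj, hj] at h1
    exact (zpow_lt_zpow_iff_right₀ hp1).mp h1
  have hjneg : ∀ k, j k < 0 := fun k => by
    have h1 := pow_lt_one₀ zero_le (hδ1 k) hN0
    rw [hj, ← zpow_zero (p : ℝ≥0)] at h1
    exact (zpow_lt_zpow_iff_right₀ hp1).mp h1
  have hjge : ∀ k : ℕ, j 0 + k ≤ j k := fun k => by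
    induction k with
    | zero => simp
    | succ k ih =>
      have : j k < j (k + 1) := hjmono k.lt_succ_self
      push_cast
      omega
  have h1 := hjge (-j 0).toNat
  have h2 := hjneg (-j 0).toNat
  omega

end Ramification
end Arboreal

theorem mainTheorem4 (p : ℕ) [Fact p.Prime] (K : Type*) [Field K] [Algebra ℚ_[p] K]
    [FiniteDimensional ℚ_[p] K] (f : RatFunc K) (hf : Arboreal.HasGoodReduction p f)
    (hd_pos : 1 ≤ Arboreal.ratDegree f) (hd_lt : Arboreal.ratDegree f < p) (a : OnePoint K)
    (ha : Arboreal.IsInfinitelyRamified p (Arboreal.arborealRep f a)) :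
    ∃ B : Arboreal.Branch f a, Arboreal.IsInfinitelyRamified p B.rep := by
  have hd : Arboreal.ratDegree f ≠ 0 := Nat.one_le_iff_ne_zero.mp hd_pos
  obtain ⟨P, Q, h⟩ := hf.exists_isGoodModel p (AlgebraicClosure K) hd
  have hb : ∀ σ : AlgebraicClosure K ≃ₐ[K] AlgebraicClosure K,
      (a.map (algebraMap K (AlgebraicClosure K))).map σ =
        a.map (algebraMap K (AlgebraicClosure K)) := fun σ => by
    induction a using OnePoint.rec <;> simp
  by_contra hno
  obtain ⟨S, hS, hiso⟩ := h.exists_finite_contracting hd hd_lt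
  obtain ⟨L, hL, hfix⟩ := h.exists_inertia_fixes hd hd_lt hb (fun n x hx hper σ hσ => by
    by_contra hσx
    exact hno (h.exists_branch hd hb hx hper hσ hσx)) S.ncard
  refine (Arboreal.isInfinitelyRamified_iff p _).mp ha L hL fun σ hσ => ?_
  refine Arboreal.mem_ker_treeRep.mpr fun v hv => hfix v.1 v.2 hv ?_ σ hσ
  exact Arboreal.ramifiedCount_le hS hiso v.1 v.2
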